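/- Let $N\ge 1$ be an integer, $s\in(0,1)$, $q\in(1,2)$, and let $\Omega\subset\mathbb R^N$ be an open set. For $v:\mathbb R^N\to\mathbb R$ measurable write $$[v]^2=\int_{\mathbb R^N}\int_{\mathbb R^N}\frac{(v(x)-v(y))^2}{|x-y|^{N+2s}}\,dx\,dy .$$ For an open set $U\subset\mathbb R^N$ let $\mathcal D^{s,2}_0(U)$ be the completion of $C_c^\infty(U)$ with respect to the norm $[\,\cdot\,]$, and let $$\lambda_1(U,s,q)=\inf\Big\{[\varphi]^2:\ \varphi\in C_c^\infty(U),\ \int_U|\varphi|^q\,dx=1\Big\}.$$ If $\lambda_1(U,s,q)>0$ (for example, if $U$ is bounded), then $\mathcal D^{s,2}_0(U)$ is a space of functions that embeds into $L^q(U)$, and the fractional Lane–Emden density $w_{U,s,q}$ of $U$ is the unique minimiser of $$\frac12[\varphi]^2-\frac1q\int_U\varphi^q\,dx$$ among all $\varphi\in\mathcal D^{s,2}_0(U)$ with $\varphi\ge0$ a.e. in $U$. If $\lambda_1(U,s,q)=0$, the density is defined as $w_{U,s,q}(x)=\lim_{r\to\infty}w_{U\cap B_r,s,q}(x)\in[0,\infty]$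 for a.e. $x\in U$, where $B_r$ is the ball of radius $r$ centred at the origin and the limit is taken along integer radii. Then, for every $u\in C_c^\infty(\Omega)$, $$\int_\Omega\frac{u^2}{w_{\Omega,s,q}^{\,2-q}}\,dx\le\int_{\mathbb R^N}\int_{\mathbb R^N}\frac{(u(x)-u(y))^2}{|x-y|^{N+2s}}\,dx\,dy,$$ with the agreement that the integrand on the left is $0$ at all points where $w_{\Omega,s,q}=+\infty$. -/

import Mathlib

open MeasureTheory Filter Topology
open scoped ENNReal ContDiff

noncomputable section

namespace FracLaneEmden

/-- `φ ∈ C_c^∞(Ω)`: smooth, with compact support contained in `Ω`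
(extended by `0` to the whole space). -/
structure IsTestFunction {N : ℕ} (Ω : Set (EuclideanSpace ℝ (Fin N)))
    (φ : EuclideanSpace ℝ (Fin N) → ℝ) : Prop where
  smooth : ContDiff ℝ ∞ φ
  compact : HasCompactSupport φ
  supp : tsupport φ ⊆ Ω

/-- The Gagliardo double integral `∬ (u(x) - u(y))² / |x - y|^(N + 2s) dx dy` over `ℝ^N × ℝ^N`,
with values in `[0, ∞]`. -/
def gagliardo {N : ℕ} (s : ℝ) (u : EuclideanSpace ℝ (Fin N) → ℝ) : ℝ≥0∞ :=
  ∫⁻ x, ∫⁻ y, ENNReal.ofReal ((u x - u y) ^ 2 / ‖x - y‖ ^ ((N : ℝ) + 2 * s))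

/-- `∫_Ω |u|^q dx`, with values in `[0, ∞]`. -/
def powerIntegral {N : ℕ} (q : ℝ) (Ω : Set (EuclideanSpace ℝ (Fin N)))
    (u : EuclideanSpace ℝ (Fin N) → ℝ) : ℝ≥0∞ :=
  ∫⁻ x in Ω, ENNReal.ofReal (|u x| ^ q)

/-- The first `q`-semilinear `s`-eigenvalue `λ₁(Ω, s, q)`: the infimum of the Gagliardo double
integral over all `φ ∈ C_c^∞(Ω)` with `∫_Ω |φ|^q = 1` (it is `∞` if `Ω` is empty). -/
def lambda1 {N : ℕ} (s q : ℝ) (Ω : Set (EuclideanSpace ℝ (Fin N))) : ℝ≥0∞ :=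
  ⨅ (φ : EuclideanSpace ℝ (Fin N) → ℝ) (_ : IsTestFunction Ω φ) (_ : powerIntegral q Ω φ = 1),
    gagliardo s φ

/-- Membership in `𝓓₀^{s,2}(Ω)`, the completion of `C_c^∞(Ω)` with respect to the square root of
the Gagliardo double integral, realised as a space of functions on `ℝ^N`: `u` is the limit, both
in the Gagliardo norm and almost everywhere, of a sequence of test functions.
It is used only when `λ₁(Ω, s, q) > 0` for some `q ∈ (1,2)`. Then Cauchy sequences of test functions
converge in `L^q`, hence almost everywhere along a subsequence, and the a.e. limit determines the
element of the completion, so that this is the completion itself. -/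
def MemD0 {N : ℕ} (s : ℝ) (Ω : Set (EuclideanSpace ℝ (Fin N)))
    (u : EuclideanSpace ℝ (Fin N) → ℝ) : Prop :=
  ∃ φ : ℕ → EuclideanSpace ℝ (Fin N) → ℝ,
    (∀ n, IsTestFunction Ω (φ n)) ∧
    Tendsto (fun n => gagliardo s (u - φ n)) atTop (𝓝 0) ∧
    ∀ᵐ x, Tendsto (fun n => φ n x) atTop (𝓝 (u x))

/-- The free energy `½ ∬ (φ(x) - φ(y))² / |x - y|^(N + 2s) dx dy - (1/q) ∫_Ω |φ|^q dx`.
Both terms are finite for `φ ∈ 𝓓₀^{s,2}(Ω)` when `λ₁(Ω, s, q) > 0`. -/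
def freeEnergy {N : ℕ} (s q : ℝ) (Ω : Set (EuclideanSpace ℝ (Fin N)))
    (φ : EuclideanSpace ℝ (Fin N) → ℝ) : ℝ :=
  1 / 2 * (gagliardo s φ).toReal - 1 / q * (powerIntegral q Ω φ).toReal

/-- `w` minimises the free energy among the elements of `𝓓₀^{s,2}(Ω)` that are non-negative
almost everywhere in `Ω`. -/
structure IsLeastEnergy {N : ℕ} (s q : ℝ) (Ω : Set (EuclideanSpace ℝ (Fin N)))
    (w : EuclideanSpace ℝ (Fin N) → ℝ) : Prop where
  mem : MemD0 s Ω w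
  nonneg : ∀ᵐ x ∂(volume.restrict Ω), 0 ≤ w x
  le : ∀ φ, MemD0 s Ω φ → (∀ᵐ x ∂(volume.restrict Ω), 0 ≤ φ x) →
    freeEnergy s q Ω w ≤ freeEnergy s q Ω φ

open Classical in
/-- (A representative of) the minimiser of the free energy among the non-negative elements of
`𝓓₀^{s,2}(Ω)`. It exists, and is unique up to null sets, when `λ₁(Ω, s, q) > 0`.
The default value `0` is the least favourable one in the Lane–Emden inequality. -/
def leastEnergy {N : ℕ} (s q : ℝ) (Ω : Set (EuclideanSpace ℝ (Fin N))) :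
    EuclideanSpace ℝ (Fin N) → ℝ :=
  if h : ∃ w, IsLeastEnergy s q Ω w then h.choose else 0

open Classical in
/-- The `(s,q)`-Lane–Emden density `w_{Ω,s,q}`, with values in `[0, ∞]`. If `λ₁(Ω, s, q) > 0`, it is
the minimiser of the free energy; otherwise it is the limit of the densities of `Ω ∩ B_r` as
`r → ∞`. These are non-decreasing in `r` up to null sets, so that the limit exists almost everywhere
along the integer radii, where it is the upper limit written below. -/
def laneEmdenDensity {N : ℕ} (s q : ℝ) (Ω : Set (EuclideanSpace ℝ (Fin N)))
    (x : EuclideanSpace ℝ (Fin N)) : ℝ≥0∞ :=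
  if 0 < lambda1 s q Ω then ENNReal.ofReal (leastEnergy s q Ω x)
  else limsup (fun n : ℕ => ENNReal.ofReal (leastEnergy s q (Ω ∩ Metric.ball 0 (n : ℝ)) x)) atTop

end FracLaneEmden

end

/-!
The energies are convex along hidden segments: the Gagliardo energy of `√(φ² + ψ²)` is at most
`[φ]² + [ψ]²`, because `√(a² + b²)` is `1`-Lipschitz as a function of `(a, b)`. Let `w` be the
minimiser, `m` its free energy, `u` a competitor and `t > 0`. Comparing `w` with `√(w² + t u²)`
gives
`m + (1/q) ∫ (w² + t u²)^(q/2) ≤ ½ ([w]² + t [u]²)`,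
and bounding the concave power from below by its tangent line at `w² + t u²` leaves
`∫ u² / (w² + t u²)^(1 - q/2) ≤ [u]²`. As `t → 0`, Fatou's lemma yields the inequality.

The same convexity produces the minimiser. The energy of `√((φ² + ψ²)/2)` and the strong concavity
of `r ↦ r^(q/2)` control the `L¹` distance of `|φ|^q` and `|ψ|^q` for almost minimisers `φ, ψ ≥ 0`,
so that the `q`-th powers along a minimising sequence are Cauchy; the parallelogram law then makes
the sequence Cauchy for the Gagliardo seminorm.

If `λ₁ = 0`, the sets `Ω ∩ B_n` are bounded, so that they have `λ₁ > 0` by a fractional Poincaré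
inequality, and Fatou's lemma passes to the limit `n → ∞`.
-/

namespace FracLaneEmden

variable {N : ℕ}

local notation "𝔼" N:max => EuclideanSpace ℝ (Fin N)

section Gagliardo

variable {s : ℝ} {u v g : 𝔼 N → ℝ} {f : ℕ → 𝔼 N → ℝ}

/-- The measure `‖x - y‖ ^ (-(N + 2 s)) dx dy` on `ℝ^N × ℝ^N`. The Gagliardo double integral of `u`
is the squared norm of the increment `(x, y) ↦ u x - u y` in the `L²` space of this measure. -/
noncomputable def gagliardoMeasure (N : ℕ) (s : ℝ) : Measure (𝔼 N × 𝔼 N) :=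
  volume.withDensity fun p => ENNReal.ofReal (‖p.1 - p.2‖ ^ ((N : ℝ) + 2 * s))⁻¹

lemma ae_gagliardoMeasure {P : 𝔼 N → Prop} (h : ∀ᵐ x, P x) :
    ∀ᵐ p ∂gagliardoMeasure N s, P p.1 ∧ P p.2 := by
  refine withDensity_absolutelyContinuous _ _ |>.ae_le ?_
  exact (Measure.quasiMeasurePreserving_fst.ae h).and (Measure.quasiMeasurePreserving_snd.ae h)

lemma aemeasurable_increment (hu : AEMeasurable u) :
    AEMeasurable (fun p : 𝔼 N × 𝔼 N => u p.1 - u p.2) (gagliardoMeasure N s) :=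
  (hu.comp_fst.sub hu.comp_snd).mono_ac (withDensity_absolutelyContinuous _ _)

lemma gagliardo_eq_lintegral (hu : AEMeasurable u) :
    gagliardo s u = ∫⁻ p, ENNReal.ofReal ((u p.1 - u p.2) ^ 2) ∂gagliardoMeasure N s := by
  have hincr : AEMeasurable (fun p : 𝔼 N × 𝔼 N => u p.1 - u p.2) := hu.comp_fst.sub hu.comp_snd
  rw [gagliardoMeasure, lintegral_withDensity_eq_lintegral_mul₀ (by fun_prop)
    (hincr.pow_const 2).ennreal_ofReal, Measure.volume_eq_prod, lintegral_prod _ (by fun_prop)]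
  refine lintegral_congr fun x => lintegral_congr fun y => ?_
  rw [Pi.mul_apply, ← ENNReal.ofReal_mul (by positivity), div_eq_inv_mul]

lemma gagliardo_rpow_half_eq_eLpNorm (hu : AEMeasurable u) :
    gagliardo s u ^ (2⁻¹ : ℝ) = eLpNorm (fun p => u p.1 - u p.2) 2 (gagliardoMeasure N s) := by
  rw [gagliardo_eq_lintegral hu, eLpNorm_eq_lintegral_rpow_enorm_toReal two_ne_zero
    ENNReal.ofNat_ne_top]
  simp [Real.enorm_eq_ofReal_abs, ← ENNReal.ofReal_pow]

lemma gagliardo_const_smul (c : ℝ) (u : 𝔼 N → ℝ) :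
    gagliardo s (c • u) = ENNReal.ofReal (c ^ 2) * gagliardo s u := by
  simp only [gagliardo, ← lintegral_const_mul' _ _ ENNReal.ofReal_ne_top,
    ← ENNReal.ofReal_mul (sq_nonneg c), Pi.smul_apply, smul_eq_mul, ← mul_sub, mul_pow,
    mul_div_assoc]

@[simp]
lemma gagliardo_zero : gagliardo s (0 : 𝔼 N → ℝ) = 0 := by
  simp [gagliardo]

lemma gagliardo_sub_comm (u v : 𝔼 N → ℝ) : gagliardo s (u - v) = gagliardo s (v - u) := by
  rw [← neg_sub, ← neg_one_smul ℝ, gagliardo_const_smul]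
  simp

lemma gagliardo_le_add_of_sq_le (hg : AEMeasurable g) (hu : AEMeasurable u) (hv : AEMeasurable v)
    (h : ∀ x y, (g x - g y) ^ 2 ≤ (u x - u y) ^ 2 + (v x - v y) ^ 2) :
    gagliardo s g ≤ gagliardo s u + gagliardo s v := by
  rw [gagliardo_eq_lintegral hg, gagliardo_eq_lintegral hu, gagliardo_eq_lintegral hv,
    ← lintegral_add_left' ((aemeasurable_increment hu).pow_const 2).ennreal_ofReal]
  refine lintegral_mono fun p => ?_
  rw [← ENNReal.ofReal_add (sq_nonneg _) (sq_nonneg _)]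
  exact ENNReal.ofReal_le_ofReal (h p.1 p.2)

lemma gagliardo_add_add_gagliardo_sub (hu : AEMeasurable u) (hv : AEMeasurable v) :
    gagliardo s (u + v) + gagliardo s (u - v) = 2 * (gagliardo s u + gagliardo s v) := by
  rw [gagliardo_eq_lintegral (hu.add hv), gagliardo_eq_lintegral (hu.sub hv),
    gagliardo_eq_lintegral hu, gagliardo_eq_lintegral hv,
    ← lintegral_add_left' ((aemeasurable_increment hu).pow_const 2).ennreal_ofReal,
    ← lintegral_add_left' ((aemeasurable_increment (hu.add hv)).pow_const 2).ennreal_ofReal,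
    ← lintegral_const_mul' _ _ ENNReal.ofNat_ne_top]
  refine lintegral_congr fun p => ?_
  rw [← ENNReal.ofReal_ofNat 2, ← ENNReal.ofReal_add (by positivity) (by positivity),
    ← ENNReal.ofReal_add (by positivity) (by positivity), ← ENNReal.ofReal_mul (by positivity)]
  congr 1
  simp only [Pi.add_apply, Pi.sub_apply]
  ring

lemma gagliardo_add_ne_top (hu : AEMeasurable u) (hv : AEMeasurable v)
    (hu_fin : gagliardo s u ≠ ⊤) (hv_fin : gagliardo s v ≠ ⊤) : gagliardo s (u + v) ≠ ⊤ := by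
  refine ne_top_of_le_ne_top ?_ (le_self_add (b := gagliardo s (u - v)))
  rw [gagliardo_add_add_gagliardo_sub hu hv]
  finiteness

lemma gagliardo_le_liminf (hf : ∀ n, AEMeasurable (f n))
    (h : ∀ᵐ x, Tendsto (fun n => f n x) atTop (𝓝 (u x))) :
    gagliardo s u ≤ liminf (fun n => gagliardo s (f n)) atTop := by
  simp only [gagliardo_eq_lintegral (aemeasurable_of_tendsto_metrizable_ae' hf h),
    gagliardo_eq_lintegral (hf _)]
  refine le_trans (lintegral_mono_ae ?_)
    (lintegral_liminf_le' fun n => ((aemeasurable_increment (hf n)).pow_const 2).ennreal_ofReal)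
  filter_upwards [ae_gagliardoMeasure h] with p hp
  exact (ENNReal.tendsto_ofReal ((hp.1.sub hp.2).pow 2)).liminf_eq.ge

lemma gagliardo_le_of_tendsto (hf : ∀ n, AEMeasurable (f n))
    (h : ∀ᵐ x, Tendsto (fun n => f n x) atTop (𝓝 (u x))) {C : ℝ≥0∞}
    (hC : ∀ᶠ n in atTop, gagliardo s (f n) ≤ C) : gagliardo s u ≤ C :=
  (gagliardo_le_liminf hf h).trans (liminf_le_of_frequently_le' hC.frequently)

lemma tendsto_gagliardo_sub_of_cauchy (hf : ∀ n, AEMeasurable (f n))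
    (hcauchy : Tendsto (fun k : ℕ × ℕ => gagliardo s (f k.1 - f k.2)) atTop (𝓝 0))
    (h : ∀ᵐ x, Tendsto (fun n => f n x) atTop (𝓝 (u x))) :
    Tendsto (fun n => gagliardo s (u - f n)) atTop (𝓝 0) := by
  refine ENNReal.tendsto_nhds_zero.2 fun ε hε => ?_
  obtain ⟨k, hk⟩ := eventually_atTop.1 (ENNReal.tendsto_nhds_zero.1 hcauchy ε hε)
  filter_upwards [eventually_ge_atTop k.2] with n hn
  refine gagliardo_le_of_tendsto (fun l => (hf l).sub (hf n))
    (h.mono fun x hx => hx.sub_const (f n x)) ?_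
  filter_upwards [eventually_ge_atTop k.1] with l hl
  exact hk (l, n) ⟨hl, hn⟩

lemma gagliardo_rpow_half_le_add (hu : AEMeasurable u) (hv : AEMeasurable v) :
    gagliardo s u ^ (2⁻¹ : ℝ) ≤
      gagliardo s v ^ (2⁻¹ : ℝ) + gagliardo s (u - v) ^ (2⁻¹ : ℝ) := by
  rw [gagliardo_rpow_half_eq_eLpNorm hu, gagliardo_rpow_half_eq_eLpNorm hv,
    gagliardo_rpow_half_eq_eLpNorm (hu.sub hv)]
  refine (eLpNorm_add_le (aemeasurable_increment hv).aestronglyMeasurable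
    (aemeasurable_increment (hu.sub hv)).aestronglyMeasurable one_le_two).trans' (le_of_eq ?_)
  refine congrArg (eLpNorm · 2 _) (funext fun p => ?_)
  simp only [Pi.add_apply, Pi.sub_apply]
  ring

lemma tendsto_gagliardo_of_tendsto_sub (hu : AEMeasurable u) (hf : ∀ n, AEMeasurable (f n))
    (h : Tendsto (fun n => gagliardo s (u - f n)) atTop (𝓝 0)) :
    Tendsto (fun n => gagliardo s (f n)) atTop (𝓝 (gagliardo s u)) := by
  have hdiff : Tendsto (fun n => gagliardo s (u - f n) ^ (2⁻¹ : ℝ)) atTop (𝓝 0) := by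
    simpa using h.ennrpow_const 2⁻¹
  have hsqrt : Tendsto (fun n => gagliardo s (f n) ^ (2⁻¹ : ℝ)) atTop
      (𝓝 (gagliardo s u ^ (2⁻¹ : ℝ))) := by
    refine tendsto_of_tendsto_of_tendsto_of_le_of_le
      (by simpa using ENNReal.Tendsto.sub tendsto_const_nhds hdiff (Or.inr ENNReal.zero_ne_top))
      (by simpa using tendsto_const_nhds.add hdiff) (fun n => ?_) fun n => ?_
    · exact tsub_le_iff_right.2 (gagliardo_rpow_half_le_add hu (hf n))
    · rw [gagliardo_sub_comm]
      exact gagliardo_rpow_half_le_add (hf n) hu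
  simpa only [ENNReal.rpow_inv_rpow two_ne_zero] using hsqrt.ennrpow_const 2

end Gagliardo

lemma sq_sqrt_sq_add_sq_sub_le (a b c d δ : ℝ) :
    (√(a ^ 2 + b ^ 2 + δ ^ 2) - √(c ^ 2 + d ^ 2 + δ ^ 2)) ^ 2 ≤ (a - c) ^ 2 + (b - d) ^ 2 := by
  have h₁ := Real.sq_sqrt (by positivity : 0 ≤ a ^ 2 + b ^ 2 + δ ^ 2)
  have h₂ := Real.sq_sqrt (by positivity : 0 ≤ c ^ 2 + d ^ 2 + δ ^ 2)
  have cauchy_schwarz :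
      a * c + b * d + δ ^ 2 ≤ √(a ^ 2 + b ^ 2 + δ ^ 2) * √(c ^ 2 + d ^ 2 + δ ^ 2) := by
    refine (le_abs_self _).trans (abs_le_of_sq_le_sq ?_ (by positivity))
    rw [mul_pow, h₁, h₂]
    nlinarith [sq_nonneg (a * d - b * c), sq_nonneg (δ * (a - c)), sq_nonneg (δ * (b - d))]
  nlinarith

lemma abs_rpow_eq_sq_rpow (a q : ℝ) : |a| ^ q = (a ^ 2) ^ (q / 2) := by
  rw [← sq_abs, ← Real.rpow_natCast, ← Real.rpow_mul (abs_nonneg _), Nat.cast_ofNat,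
    mul_div_cancel₀ q two_ne_zero]

namespace IsTestFunction

variable {q : ℝ} {Ω : Set (𝔼 N)} {φ ψ : 𝔼 N → ℝ}

protected lemma continuous (hφ : IsTestFunction Ω φ) : Continuous φ := hφ.smooth.continuous

protected lemma aemeasurable (hφ : IsTestFunction Ω φ) : AEMeasurable φ :=
  hφ.continuous.measurable.aemeasurable

lemma eq_zero_of_notMem (hφ : IsTestFunction Ω φ) {x : 𝔼 N} (hx : x ∉ Ω) : φ x = 0 :=
  image_eq_zero_of_notMem_tsupport fun h => hx (hφ.supp h)

protected lemma zero : IsTestFunction Ω (0 : 𝔼 N → ℝ) where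
  smooth := contDiff_const
  compact := HasCompactSupport.zero
  supp := by simp [tsupport_eq_empty_iff.2 rfl]

protected lemma const_smul (hφ : IsTestFunction Ω φ) (c : ℝ) : IsTestFunction Ω (c • φ) where
  smooth := hφ.smooth.const_smul c
  compact := hφ.compact.smul_left
  supp := (tsupport_smul_subset_right (fun _ => c) φ).trans hφ.supp

protected lemma add (hφ : IsTestFunction Ω φ) (hψ : IsTestFunction Ω ψ) :
    IsTestFunction Ω (φ + ψ) where
  smooth := hφ.smooth.add hψ.smooth
  compact := hφ.compact.add hψ.compact
  supp := (tsupport_add φ ψ).trans (Set.union_subset hφ.supp hψ.supp)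

protected lemma sub (hφ : IsTestFunction Ω φ) (hψ : IsTestFunction Ω ψ) :
    IsTestFunction Ω (φ - ψ) := by
  simpa [sub_eq_add_neg] using hφ.add (hψ.const_smul (-1))

/-- Subtracting `δ` restores the compact support lost when `√(φ² + ψ²)` is made smooth. -/
protected lemma sqrt_sq_add_sq (hφ : IsTestFunction Ω φ) (hψ : IsTestFunction Ω ψ) {δ : ℝ}
    (hδ : 0 < δ) : IsTestFunction Ω (fun x => √(φ x ^ 2 + ψ x ^ 2 + δ ^ 2) - δ) := by
  have hsub : tsupport (fun x => √(φ x ^ 2 + ψ x ^ 2 + δ ^ 2) - δ) ⊆ tsupport φ ∪ tsupport ψ := by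
    refine closure_minimal (fun x => ?_) ((isClosed_tsupport _).union (isClosed_tsupport _))
    contrapose!
    intro hx
    simp only [Set.mem_union, not_or] at hx
    simp [image_eq_zero_of_notMem_tsupport hx.1, image_eq_zero_of_notMem_tsupport hx.2,
      Real.sqrt_sq hδ.le]
  refine ⟨ContDiff.sub (ContDiff.sqrt ?_ fun x => by positivity) contDiff_const,
    (hφ.compact.union hψ.compact).of_isClosed_subset (isClosed_tsupport _) hsub,
    hsub.trans (Set.union_subset hφ.supp hψ.supp)⟩
  exact ((hφ.smooth.pow 2).add (hψ.smooth.pow 2)).add contDiff_const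

lemma powerIntegral_eq_lintegral (hφ : IsTestFunction Ω φ) (hq : 0 < q) :
    powerIntegral q Ω φ = ∫⁻ x, ENNReal.ofReal (|φ x| ^ q) := by
  refine setLIntegral_eq_of_support_subset (Function.support_subset_iff'.2 fun x hx => ?_)
  simp [hφ.eq_zero_of_notMem hx, hq.ne']

lemma integrable_rpow_sq_add_sq (hφ : IsTestFunction Ω φ) (hψ : IsTestFunction Ω ψ) (hq : 0 < q) :
    Integrable (fun x => (φ x ^ 2 + ψ x ^ 2) ^ (q / 2)) := by
  have hcont : Continuous fun x => (φ x ^ 2 + ψ x ^ 2) ^ (q / 2) :=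
    ((hφ.continuous.pow 2).add (hψ.continuous.pow 2)).rpow_const fun x => Or.inr (by positivity)
  refine hcont.integrable_of_hasCompactSupport ?_
  refine HasCompactSupport.intro (hφ.compact.union hψ.compact) fun x hx => ?_
  simp only [Set.mem_union, not_or] at hx
  simp [image_eq_zero_of_notMem_tsupport hx.1, image_eq_zero_of_notMem_tsupport hx.2, hq.ne']

lemma integrable_abs_rpow (hφ : IsTestFunction Ω φ) (hq : 0 < q) :
    Integrable (fun x => |φ x| ^ q) := by
  simpa [abs_rpow_eq_sq_rpow] using hφ.integrable_rpow_sq_add_sq (.zero (Ω := Ω)) hq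

lemma powerIntegral_ne_top (hφ : IsTestFunction Ω φ) (hq : 0 < q) : powerIntegral q Ω φ ≠ ⊤ :=
  (hφ.integrable_abs_rpow hq).restrict.lintegral_lt_top.ne

lemma toReal_powerIntegral (hφ : IsTestFunction Ω φ) (hq : 0 < q) :
    (powerIntegral q Ω φ).toReal = ∫ x, |φ x| ^ q := by
  rw [hφ.powerIntegral_eq_lintegral hq, integral_eq_lintegral_of_nonneg_ae
    (ae_of_all _ fun x => by positivity) (hφ.integrable_abs_rpow hq).aestronglyMeasurable]

end IsTestFunction

section Finiteness

variable {s : ℝ}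

lemma integrableOn_pow_smul_min_one_sq_div_rpow (n : ℕ) (hs : s ∈ Set.Ioo 0 1) :
    IntegrableOn (fun r : ℝ => r ^ n • (min 1 (r ^ 2) / r ^ ((n : ℝ) + 1 + 2 * s)))
      (Set.Ioi 0) := by
  rw [← Set.Ioc_union_Ioi_eq_Ioi zero_le_one]
  refine IntegrableOn.union ?_ ?_
  · have h : IntegrableOn (fun r : ℝ => r ^ (1 - 2 * s)) (Set.Ioc 0 1) := by
      rw [← intervalIntegrable_iff_integrableOn_Ioc_of_le zero_le_one]
      exact intervalIntegral.intervalIntegrable_rpow' (by linarith [hs.2])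
    refine h.congr_fun (fun r hr => ?_) measurableSet_Ioc
    have hr0 : 0 < r := hr.1
    beta_reduce
    rw [min_eq_right (pow_le_one₀ hr0.le hr.2), smul_eq_mul, mul_div_assoc', ← Real.rpow_natCast,
      ← Real.rpow_natCast, ← Real.rpow_add hr0, ← Real.rpow_sub hr0, Nat.cast_ofNat]
    ring_nf
  · have h : IntegrableOn (fun r : ℝ => r ^ (-1 - 2 * s)) (Set.Ioi 1) :=
      integrableOn_Ioi_rpow_of_lt (by linarith [hs.1]) one_pos
    refine h.congr_fun (fun r (hr : 1 < r) => ?_) measurableSet_Ioi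
    have hr0 : 0 < r := one_pos.trans hr
    beta_reduce
    rw [min_eq_left (one_le_pow₀ hr.le), smul_eq_mul, mul_one_div, ← Real.rpow_natCast,
      ← Real.rpow_sub hr0]
    ring_nf

lemma integrable_min_one_norm_sq_div_rpow {E : Type*} [NormedAddCommGroup E] [NormedSpace ℝ E]
    [FiniteDimensional ℝ E] [Nontrivial E] [MeasurableSpace E] [BorelSpace E] (μ : Measure E)
    [μ.IsAddHaarMeasure] (hs : s ∈ Set.Ioo 0 1) :
    Integrable (fun z : E => min 1 (‖z‖ ^ 2) / ‖z‖ ^ ((Module.finrank ℝ E : ℝ) + 2 * s)) μ := by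
  rw [integrable_fun_norm_addHaar μ
    (f := fun r : ℝ => min 1 (r ^ 2) / r ^ ((Module.finrank ℝ E : ℝ) + 2 * s))]
  have hdim : ((Module.finrank ℝ E - 1 : ℕ) : ℝ) + 1 = Module.finrank ℝ E := by
    rw [Nat.cast_sub Module.finrank_pos, Nat.cast_one, sub_add_cancel]
  simpa only [hdim] using
    integrableOn_pow_smul_min_one_sq_div_rpow (Module.finrank ℝ E - 1) hs

lemma lintegral_lintegral_add_mul_sub {G : Type*} [AddGroup G] [MeasurableSpace G]
    [MeasurableAdd₂ G] [MeasurableNeg G] {μ : Measure G} [SFinite μ] [μ.IsAddLeftInvariant]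
    [μ.IsAddRightInvariant] [μ.IsNegInvariant] {f k : G → ℝ≥0∞} (hf : Measurable f)
    (hk : Measurable k) :
    ∫⁻ x, ∫⁻ y, (f x + f y) * k (x - y) ∂μ ∂μ = 2 * (∫⁻ x, f x ∂μ) * ∫⁻ z, k z ∂μ := by
  have hfst : ∫⁻ x, ∫⁻ y, f x * k (x - y) ∂μ ∂μ = (∫⁻ x, f x ∂μ) * ∫⁻ z, k z ∂μ := by
    simp_rw [← lintegral_mul_const _ hf]
    refine lintegral_congr fun x => ?_
    rw [lintegral_const_mul _ (by fun_prop), lintegral_sub_left_eq_self]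
  have hsnd : ∫⁻ x, ∫⁻ y, f y * k (x - y) ∂μ ∂μ = (∫⁻ x, f x ∂μ) * ∫⁻ z, k z ∂μ := by
    rw [lintegral_lintegral_swap (by fun_prop)]
    simp_rw [← lintegral_mul_const _ hf]
    refine lintegral_congr fun y => ?_
    rw [lintegral_const_mul _ (by fun_prop), lintegral_sub_right_eq_self]
  have hmeas (x : G) : Measurable fun y => f x * k (x - y) := by fun_prop
  simp_rw [add_mul, lintegral_add_left (hmeas _)]
  rw [lintegral_add_left (by fun_prop), hfst, hsnd, mul_assoc, two_mul]

lemma sq_sub_le_mul_min_one_sq {E : Type*} [SeminormedAddCommGroup E] {f : E → ℝ} {L : NNReal}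
    {M : ℝ} (hL : LipschitzWith L f) (hM : ∀ x, |f x| ≤ M) (x y : E) :
    (f x - f y) ^ 2 ≤ ((2 * M) ^ 2 + (L : ℝ) ^ 2) * min 1 (‖x - y‖ ^ 2) := by
  have hbound : (f x - f y) ^ 2 ≤ (2 * M) ^ 2 := by
    rw [← sq_abs]
    gcongr
    linarith [abs_sub (f x) (f y), hM x, hM y]
  have hlip : (f x - f y) ^ 2 ≤ (L : ℝ) ^ 2 * ‖x - y‖ ^ 2 := by
    rw [← sq_abs, ← mul_pow]
    gcongr
    exact hL.norm_sub_le x y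
  rw [mul_min_of_nonneg _ _ (by positivity), mul_one, le_min_iff]
  exact ⟨by linarith [sq_nonneg (L : ℝ)], by
    linarith [mul_nonneg (sq_nonneg (2 * M)) (sq_nonneg ‖x - y‖)]⟩

lemma gagliardo_ne_top_of_lipschitzWith (hN : 1 ≤ N) (hs : s ∈ Set.Ioo 0 1) {u : 𝔼 N → ℝ}
    {L : NNReal} (hL : LipschitzWith L u) (hu : HasCompactSupport u) : gagliardo s u ≠ ⊤ := by
  obtain ⟨M, hM⟩ := hu.exists_bound_of_continuous hL.continuous
  have : Nonempty (Fin N) := ⟨⟨0, hN⟩⟩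
  let K : Set (𝔼 N) := tsupport u
  have hK : MeasurableSet K := (isClosed_tsupport u).measurableSet
  let k : 𝔼 N → ℝ≥0∞ := fun z => ENNReal.ofReal
    (((2 * M) ^ 2 + (L : ℝ) ^ 2) * (min 1 (‖z‖ ^ 2) / ‖z‖ ^ ((N : ℝ) + 2 * s)))
  have hk : ∫⁻ z, k z ≠ ⊤ := by
    have := integrable_min_one_norm_sq_div_rpow (E := 𝔼 N) volume hs
    rw [finrank_euclideanSpace_fin] at this
    exact (this.const_mul _).lintegral_lt_top.ne
  have hle (x y : 𝔼 N) : ENNReal.ofReal ((u x - u y) ^ 2 / ‖x - y‖ ^ ((N : ℝ) + 2 * s)) ≤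
      (K.indicator 1 x + K.indicator 1 y) * k (x - y) := by
    by_cases hxy : x ∉ K ∧ y ∉ K
    · simp [image_eq_zero_of_notMem_tsupport hxy.1, image_eq_zero_of_notMem_tsupport hxy.2]
    · have hind : (1 : ℝ≥0∞) ≤ K.indicator 1 x + K.indicator 1 y := by
        by_cases hx : x ∈ K
        · simp [hx]
        · simp [not_and_not_right.1 hxy hx]
      refine le_mul_of_one_le_of_le hind (ENNReal.ofReal_le_ofReal ?_)
      rw [← mul_div_assoc]
      gcongr
      exact sq_sub_le_mul_min_one_sq hL hM x y
  refine ne_top_of_le_ne_top ?_ (lintegral_mono fun x => lintegral_mono fun y => hle x y)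
  rw [lintegral_lintegral_add_mul_sub (measurable_one.indicator hK) (by fun_prop),
    lintegral_indicator_one hK]
  exact ENNReal.mul_ne_top (ENNReal.mul_ne_top ENNReal.ofNat_ne_top
    hu.isCompact.measure_lt_top.ne) hk

lemma IsTestFunction.gagliardo_ne_top (hN : 1 ≤ N) (hs : s ∈ Set.Ioo 0 1) {Ω : Set (𝔼 N)}
    {φ : 𝔼 N → ℝ} (hφ : IsTestFunction Ω φ) : gagliardo s φ ≠ ⊤ := by
  obtain ⟨L, hL⟩ := hφ.smooth.lipschitzWith_of_hasCompactSupport hφ.compact (by simp)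
  exact gagliardo_ne_top_of_lipschitzWith hN hs hL hφ.compact

end Finiteness

section PowerInequalities

variable {p a b h : ℝ}

lemma strongConcaveOn_rpow (hp : p ∈ Set.Ioo 0 1) :
    StrongConcaveOn (Set.Icc 0 1) (p * (1 - p)) fun t : ℝ => t ^ p := by
  simp only [strongConcaveOn_iff_convex, Real.norm_eq_abs, sq_abs]
  refine concaveOn_of_hasDerivWithinAt2_nonpos (convex_Icc 0 1)
    (f' := fun t => p * t ^ (p - 1) + p * (1 - p) * t)
    (f'' := fun t => p * ((p - 1) * t ^ (p - 1 - 1)) + p * (1 - p)) ?_ ?_ ?_ ?_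
  · exact ((Real.continuous_rpow_const hp.1.le).add (by fun_prop)).continuousOn
  · intro t ht
    rw [interior_Icc] at ht ⊢
    have hsq := ((hasDerivAt_id t).pow 2).const_mul (p * (1 - p) / 2)
    refine ((Real.hasDerivAt_rpow_const (Or.inl ht.1.ne')).add hsq |>.congr_deriv ?_)
      |>.hasDerivWithinAt
    simp only [id_eq, Nat.cast_ofNat, Nat.add_one_sub_one, pow_one, mul_one]
    ring
  · intro t ht
    rw [interior_Icc] at ht ⊢
    have hrpow := (Real.hasDerivAt_rpow_const (p := p - 1) (Or.inl ht.1.ne')).const_mul p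
    have hlin := (hasDerivAt_id t).const_mul (p * (1 - p))
    exact (hrpow.add hlin |>.congr_deriv (by rw [mul_one])) |>.hasDerivWithinAt
  · intro t ht
    rw [interior_Icc] at ht
    have hone : 1 ≤ t ^ (p - 1 - 1) :=
      Real.one_le_rpow_of_pos_of_le_one_of_nonpos ht.1 ht.2.le (by linarith [hp.2])
    nlinarith [mul_pos hp.1 (sub_pos.2 hp.2)]

lemma mul_one_sub_sq_le_midpoint_rpow_sub (hp : p ∈ Set.Ioo 0 1) {t : ℝ} (ht : t ∈ Set.Icc 0 1) :
    p * (1 - p) / 8 * (1 - t) ^ 2 ≤ ((1 + t) / 2) ^ p - (1 + t ^ p) / 2 := by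
  have hconc := (strongConcaveOn_rpow hp).2 (Set.right_mem_Icc.2 zero_le_one) ht
    one_half_pos.le one_half_pos.le (add_halves 1)
  simp only [smul_eq_mul, Real.one_rpow, Real.norm_eq_abs, sq_abs] at hconc
  rw [show (1 / 2 : ℝ) * 1 + 1 / 2 * t = (1 + t) / 2 by ring] at hconc
  linarith

lemma mul_sq_rpow_sub_le (hp : p ∈ Set.Ioo 0 1) (ha : 0 ≤ a) (hb : 0 ≤ b) :
    p * (1 - p) / 8 * (a ^ p - b ^ p) ^ 2 ≤
      (a ^ p + b ^ p) * (((a + b) / 2) ^ p - (a ^ p + b ^ p) / 2) := by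
  wlog hab : a ≤ b generalizing a b
  · have := this hb ha (le_of_not_ge hab)
    rwa [add_comm b, add_comm (b ^ p), sub_sq_comm] at this
  rcases hb.eq_or_lt with rfl | hb_pos
  · simp [le_antisymm hab ha, Real.zero_rpow hp.1.ne']
  obtain ⟨t, rfl⟩ : ∃ t, a = t * b := ⟨a / b, (div_mul_cancel₀ _ hb_pos.ne').symm⟩
  have ht : t ∈ Set.Icc 0 1 :=
    ⟨nonneg_of_mul_nonneg_left ha hb_pos, (mul_le_iff_le_one_left hb_pos).1 hab⟩
  have hκ : 0 < p * (1 - p) / 8 := by linarith [mul_pos hp.1 (sub_pos.2 hp.2)]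
  have htp : t ≤ t ^ p := Real.self_le_rpow_of_le_one ht.1 ht.2 hp.2.le
  have htp_le_one : t ^ p ≤ 1 := Real.rpow_le_one ht.1 ht.2 hp.1.le
  have hgap := mul_one_sub_sq_le_midpoint_rpow_sub hp ht
  rw [show (t * b + b) / 2 = (1 + t) / 2 * b by ring, Real.mul_rpow ht.1 hb,
    Real.mul_rpow (by linarith [ht.1]) hb]
  calc p * (1 - p) / 8 * (t ^ p * b ^ p - b ^ p) ^ 2
      = (b ^ p) ^ 2 * (p * (1 - p) / 8 * (1 - t ^ p) ^ 2) := by ring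
    _ ≤ (b ^ p) ^ 2 * (p * (1 - p) / 8 * (1 - t) ^ 2) := by
        gcongr
    _ ≤ (b ^ p) ^ 2 * ((1 + t ^ p) * (((1 + t) / 2) ^ p - (1 + t ^ p) / 2)) := by
        refine mul_le_mul_of_nonneg_left ?_ (by positivity)
        refine hgap.trans (le_mul_of_one_le_left (hgap.trans' (by positivity)) ?_)
        linarith [ht.1]
    _ = _ := by ring

lemma half_add_sub_half_abs_sub_le_midpoint_rpow (hp : 0 ≤ p) (ha : 0 ≤ a) (hb : 0 ≤ b) :
    (a ^ p + b ^ p) / 2 - |a ^ p - b ^ p| / 2 ≤ ((a + b) / 2) ^ p := by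
  wlog hab : a ≤ b generalizing a b
  · rw [add_comm a, add_comm (a ^ p), abs_sub_comm]
    exact this hb ha (le_of_not_ge hab)
  rw [abs_of_nonpos (sub_nonpos.2 (Real.rpow_le_rpow ha hab hp))]
  have : a ^ p ≤ ((a + b) / 2) ^ p := by gcongr; linarith
  linarith

lemma rpow_le_mul_add (hp : p ∈ Set.Ico 0 1) {ε t : ℝ} (hε : 0 < ε) (ht : 0 ≤ t) :
    t ^ p ≤ ε * t + (ε ^ (p - 1)⁻¹) ^ p := by
  have ha : 0 < ε ^ (p - 1)⁻¹ := by positivity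
  rcases le_total t (ε ^ (p - 1)⁻¹) with hta | hat
  · have : t ^ p ≤ (ε ^ (p - 1)⁻¹) ^ p := Real.rpow_le_rpow ht hta hp.1
    linarith [mul_nonneg hε.le ht]
  · have ht_pos : 0 < t := ha.trans_le hat
    have hslope : t ^ (p - 1) ≤ ε := by
      refine (Real.rpow_le_rpow_of_nonpos ha hat (by linarith [hp.2])).trans_eq ?_
      exact Real.rpow_inv_rpow hε.le (by linarith [hp.2])
    calc t ^ p = t ^ (p - 1) * t := by rw [← Real.rpow_add_one ht_pos.ne', sub_add_cancel]
      _ ≤ ε * t := by gcongr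
      _ ≤ ε * t + (ε ^ (p - 1)⁻¹) ^ p := le_add_of_nonneg_right (by positivity)

lemma mul_div_rpow_add_rpow_le (hp : p ∈ Set.Icc 0 1) (ha : 0 ≤ a) (hh : 0 ≤ h) :
    p * (h / (a + h) ^ (1 - p)) + a ^ p ≤ (a + h) ^ p := by
  rcases (add_nonneg ha hh).eq_or_lt with hzero | hpos
  · obtain ⟨rfl, rfl⟩ := (add_eq_zero_iff_of_nonneg ha hh).1 hzero.symm
    simp
  have hpow : 0 < (a + h) ^ (1 - p) := by positivity
  have hmean : a ^ p * (a + h) ^ (1 - p) ≤ p * a + (1 - p) * (a + h) :=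
    Real.geom_mean_le_arith_mean2_weighted hp.1 (by linarith [hp.2]) ha hpos.le (by ring)
  have hsplit : (a + h) ^ p * (a + h) ^ (1 - p) = a + h := by
    rw [← Real.rpow_add hpos, add_sub_cancel, Real.rpow_one]
  refine le_of_mul_le_mul_right ?_ hpow
  rw [hsplit, add_mul, mul_assoc, div_mul_cancel₀ _ hpow.ne']
  linarith

end PowerInequalities

section Integration

variable {α : Type*} [MeasurableSpace α] {μ : Measure α}

lemma sq_integral_abs_le_mul {f g h : α → ℝ} (hg : Integrable g μ) (hh : Integrable h μ)
    (hg_nonneg : 0 ≤ g) (hh_nonneg : 0 ≤ h) (hfgh : ∀ x, f x ^ 2 ≤ g x * h x) :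
    (∫ x, |f x| ∂μ) ^ 2 ≤ (∫ x, g x ∂μ) * ∫ x, h x ∂μ := by
  have hsqrt {k : α → ℝ} (hk : Integrable k μ) (hk_nonneg : 0 ≤ k) :
      MemLp (fun x => √(k x)) 2 μ := by
    rw [memLp_two_iff_integrable_sq
      (Real.continuous_sqrt.comp_aestronglyMeasurable hk.aestronglyMeasurable)]
    simpa only [Real.sq_sqrt (hk_nonneg _)] using hk
  have holder : ∫ x, √(g x) * √(h x) ∂μ ≤ √(∫ x, g x ∂μ) * √(∫ x, h x ∂μ) := by
    simpa only [Real.rpow_two, Real.sq_sqrt (hg_nonneg _), Real.sq_sqrt (hh_nonneg _),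
      ← Real.sqrt_eq_rpow] using integral_mul_le_Lp_mul_Lq_of_nonneg (μ := μ) .two_two
        (ae_of_all _ fun x => Real.sqrt_nonneg (g x)) (ae_of_all _ fun x => Real.sqrt_nonneg (h x))
        (by simpa using hsqrt hg hg_nonneg) (by simpa using hsqrt hh hh_nonneg)
  have hle : ∫ x, |f x| ∂μ ≤ ∫ x, √(g x) * √(h x) ∂μ := by
    refine integral_mono_of_nonneg (ae_of_all _ fun x => abs_nonneg _)
      ((hsqrt hg hg_nonneg).integrable_mul (hsqrt hh hh_nonneg)) (ae_of_all _ fun x => ?_)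
    beta_reduce
    rw [← Real.sqrt_mul (hg_nonneg x)]
    exact Real.abs_le_sqrt (hfgh x)
  calc (∫ x, |f x| ∂μ) ^ 2 ≤ (√(∫ x, g x ∂μ) * √(∫ x, h x ∂μ)) ^ 2 := by
        gcongr
        exact hle.trans holder
    _ = _ := by
        rw [mul_pow, Real.sq_sqrt (integral_nonneg hg_nonneg),
          Real.sq_sqrt (integral_nonneg hh_nonneg)]

lemma exists_integrable_tendsto_eLpNorm_of_cauchy {E : Type*} [NormedAddCommGroup E]
    [CompleteSpace E] {f : ℕ → α → E} (hf : ∀ n, Integrable (f n) μ)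
    (hcauchy : Tendsto (fun k : ℕ × ℕ => ∫ x, ‖f k.1 x - f k.2 x‖ ∂μ) atTop (𝓝 0)) :
    ∃ g, Integrable g μ ∧ Tendsto (fun n => eLpNorm (f n - g) 1 μ) atTop (𝓝 0) := by
  have hcauchy' : CauchySeq fun n => (hf n).toL1 (f n) := by
    refine cauchySeq_iff_tendsto_dist_atTop_0.2 (hcauchy.congr fun k => ?_)
    rw [dist_eq_norm, ← Integrable.toL1_sub, L1.norm_of_fun_eq_integral_norm]
    rfl
  obtain ⟨g, hg⟩ := cauchySeq_tendsto_of_complete hcauchy'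
  refine ⟨g, L1.integrable_coeFn g, ?_⟩
  rw [← Lp.toLp_coeFn g (Lp.memLp g)] at hg
  exact (Lp.tendsto_Lp_iff_tendsto_eLpNorm'' f (fun n => memLp_one_iff_integrable.2 (hf n)) g
    (Lp.memLp g)).1 hg

end Integration

section Energy

variable {s q m : ℝ} {Ω : Set (𝔼 N)} {φ : 𝔼 N → ℝ}

lemma powerIntegral_const_smul (c : ℝ) (u : 𝔼 N → ℝ) :
    powerIntegral q Ω (c • u) = ENNReal.ofReal (|c| ^ q) * powerIntegral q Ω u := by
  have hc : 0 ≤ |c| ^ q := by positivity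
  simp only [powerIntegral, ← lintegral_const_mul' _ _ ENNReal.ofReal_ne_top,
    ← ENNReal.ofReal_mul hc, Pi.smul_apply, smul_eq_mul, abs_mul,
    Real.mul_rpow (abs_nonneg _) (abs_nonneg _)]

lemma lambda1_mul_powerIntegral_rpow_le (hq : 0 < q) (hφ : IsTestFunction Ω φ) :
    lambda1 s q Ω * powerIntegral q Ω φ ^ (2 / q) ≤ gagliardo s φ := by
  rcases eq_or_ne (powerIntegral q Ω φ) 0 with hP | hP
  · simp [hP, ENNReal.zero_rpow_of_pos (div_pos two_pos hq)]
  obtain ⟨P, hPpos, hPφ⟩ : ∃ P : ℝ, 0 < P ∧ powerIntegral q Ω φ = ENNReal.ofReal P :=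
    ⟨_, ENNReal.toReal_pos hP (hφ.powerIntegral_ne_top hq),
      (ENNReal.ofReal_toReal (hφ.powerIntegral_ne_top hq)).symm⟩
  have hunit : powerIntegral q Ω (P ^ (-1 / q) • φ) = 1 := by
    rw [powerIntegral_const_smul, hPφ, ← ENNReal.ofReal_mul (by positivity),
      abs_of_pos (by positivity), ← Real.rpow_mul hPpos.le, div_mul_cancel₀ _ hq.ne',
      Real.rpow_neg_one, inv_mul_cancel₀ hPpos.ne', ENNReal.ofReal_one]
  have hscale : (P ^ (-1 / q)) ^ 2 * P ^ (2 / q) = 1 := by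
    rw [← Real.rpow_natCast, ← Real.rpow_mul hPpos.le, ← Real.rpow_add hPpos]
    convert Real.rpow_zero P using 2
    push_cast
    ring
  calc lambda1 s q Ω * powerIntegral q Ω φ ^ (2 / q)
      ≤ gagliardo s (P ^ (-1 / q) • φ) * powerIntegral q Ω φ ^ (2 / q) := by
        gcongr
        exact iInf₂_le_of_le _ (hφ.const_smul _) (iInf_le _ hunit)
    _ = ENNReal.ofReal ((P ^ (-1 / q)) ^ 2 * P ^ (2 / q)) * gagliardo s φ := by
        rw [gagliardo_const_smul, hPφ, ENNReal.ofReal_rpow_of_pos hPpos,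
          ENNReal.ofReal_mul (sq_nonneg _), mul_right_comm]
    _ = gagliardo s φ := by rw [hscale, ENNReal.ofReal_one, one_mul]

lemma exists_toReal_powerIntegral_le_freeEnergy (hN : 1 ≤ N) (hs : s ∈ Set.Ioo 0 1)
    (hq : q ∈ Set.Ioo 0 2) (hl : 0 < lambda1 s q Ω) :
    ∃ C, ∀ φ, IsTestFunction Ω φ →
      (powerIntegral q Ω φ).toReal ≤ q * freeEnergy s q Ω φ + C := by
  obtain ⟨c, hc_pos, hc⟩ := ENNReal.lt_iff_exists_nnreal_btwn.1 hl
  have hq_pos : 0 < q := hq.1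
  replace hc_pos : (0 : ℝ) < c := by simpa using hc_pos
  obtain ⟨K, hK⟩ : ∃ K, ∀ t, 0 ≤ t → t ^ (q / 2) ≤ q * c / 4 * t + K :=
    ⟨_, fun t => rpow_le_mul_add ⟨by positivity, by linarith [hq.2]⟩ (by positivity)⟩
  refine ⟨2 * K, fun φ hφ => ?_⟩
  set P := (powerIntegral q Ω φ).toReal
  have hP_nonneg : 0 ≤ P := ENNReal.toReal_nonneg
  have hcP : c * P ^ (2 / q) ≤ (gagliardo s φ).toReal := by
    have hle := (mul_le_mul_left hc.le _).trans (lambda1_mul_powerIntegral_rpow_le hq.1 hφ)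
    simpa [← ENNReal.toReal_rpow] using ENNReal.toReal_mono (hφ.gagliardo_ne_top hN hs) hle
  have hcoercive : P ≤ q / 4 * (gagliardo s φ).toReal + K := by
    calc P = (P ^ (2 / q)) ^ (q / 2) := by
          rw [← Real.rpow_mul hP_nonneg, div_mul_div_cancel₀ hq_pos.ne', div_self two_ne_zero,
            Real.rpow_one]
      _ ≤ q * c / 4 * P ^ (2 / q) + K := hK _ (by positivity)
      _ = q / 4 * (c * P ^ (2 / q)) + K := by ring
      _ ≤ q / 4 * (gagliardo s φ).toReal + K := by gcongr
  have hfree : q * freeEnergy s q Ω φ = q / 2 * (gagliardo s φ).toReal - P := by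
    unfold freeEnergy
    field_simp
    rfl
  linarith

/-- The free energies of the nonnegative test functions. Their infimum is also the minimum of the
free energy over the nonnegative elements of `𝓓₀^{s,2}(Ω)`. -/
def testEnergies (s q : ℝ) (Ω : Set (𝔼 N)) : Set ℝ :=
  freeEnergy s q Ω '' {φ | IsTestFunction Ω φ ∧ ∀ x, 0 ≤ φ x}

lemma le_freeEnergy_of_mem_lowerBounds (hm : m ∈ lowerBounds (testEnergies s q Ω))
    (hφ : IsTestFunction Ω φ) (hφ_nonneg : ∀ x, 0 ≤ φ x) : m ≤ freeEnergy s q Ω φ :=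
  hm ⟨φ, ⟨hφ, hφ_nonneg⟩, rfl⟩

lemma zero_mem_testEnergies (hq : 0 < q) : 0 ∈ testEnergies s q Ω :=
  ⟨0, ⟨.zero, fun _ => le_rfl⟩, by simp [freeEnergy, powerIntegral, hq.ne']⟩

lemma exists_isGLB_testEnergies (hN : 1 ≤ N) (hs : s ∈ Set.Ioo 0 1) (hq : q ∈ Set.Ioo 0 2)
    (hl : 0 < lambda1 s q Ω) : ∃ m, IsGLB (testEnergies s q Ω) m := by
  obtain ⟨C, hC⟩ := exists_toReal_powerIntegral_le_freeEnergy hN hs hq hl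
  refine ⟨_, isGLB_csInf ⟨0, zero_mem_testEnergies hq.1⟩ ⟨-C / q, ?_⟩⟩
  rintro _ ⟨φ, ⟨hφ, -⟩, rfl⟩
  rw [div_le_iff₀' hq.1, neg_le_iff_add_nonneg]
  exact ENNReal.toReal_nonneg.trans (hC φ hφ)

end Energy

/-- Hidden convexity: `√(φ² + ψ²)`, smoothed by `δ`, serves as a competitor. -/
lemma IsTestFunction.lintegral_sqrt_sq_add_sq_rpow_le {s q m δ : ℝ} {Ω : Set (𝔼 N)}
    {φ ψ : 𝔼 N → ℝ} (hN : 1 ≤ N) (hs : s ∈ Set.Ioo 0 1) (hq : 0 < q)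
    (hm : m ∈ lowerBounds (testEnergies s q Ω)) (hφ : IsTestFunction Ω φ)
    (hψ : IsTestFunction Ω ψ) (hδ : 0 < δ) :
    ∫⁻ x, ENNReal.ofReal (|√(φ x ^ 2 + ψ x ^ 2 + δ ^ 2) - δ| ^ q) ≤
      ENNReal.ofReal (q * ((gagliardo s φ + gagliardo s ψ).toReal / 2 - m)) := by
  set g : 𝔼 N → ℝ := fun x => √(φ x ^ 2 + ψ x ^ 2 + δ ^ 2) - δ
  have hg : IsTestFunction Ω g := hφ.sqrt_sq_add_sq hψ hδ
  have hg_nonneg (x : 𝔼 N) : 0 ≤ g x :=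
    sub_nonneg.2 (Real.le_sqrt_of_sq_le (le_add_of_nonneg_left (by positivity)))
  have hg_le : (gagliardo s g).toReal ≤ (gagliardo s φ + gagliardo s ψ).toReal := by
    refine ENNReal.toReal_mono
      (ENNReal.add_ne_top.2 ⟨hφ.gagliardo_ne_top hN hs, hψ.gagliardo_ne_top hN hs⟩)
      (gagliardo_le_add_of_sq_le hg.aemeasurable hφ.aemeasurable hψ.aemeasurable fun x y => ?_)
    simpa [g] using sq_sqrt_sq_add_sq_sub_le (φ x) (ψ x) (φ y) (ψ y) δ
  have hmg := le_freeEnergy_of_mem_lowerBounds hm hg hg_nonneg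
  rw [← hg.powerIntegral_eq_lintegral hq, ← ENNReal.ofReal_toReal (hg.powerIntegral_ne_top hq)]
  refine ENNReal.ofReal_le_ofReal ((inv_mul_le_iff₀ hq).1 ?_)
  rw [freeEnergy, one_div q] at hmg
  linarith

lemma IsTestFunction.memD0 {s : ℝ} {Ω : Set (𝔼 N)} {φ : 𝔼 N → ℝ} (hφ : IsTestFunction Ω φ) :
    MemD0 s Ω φ :=
  ⟨fun _ => φ, fun _ => hφ, by simp, ae_of_all _ fun _ => tendsto_const_nhds⟩

namespace MemD0

variable {s q m : ℝ} {Ω : Set (𝔼 N)} {v w : 𝔼 N → ℝ}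

protected lemma aemeasurable (hw : MemD0 s Ω w) : AEMeasurable w := by
  obtain ⟨φ, hφ, -, hae⟩ := hw
  exact aemeasurable_of_tendsto_metrizable_ae' (fun n => (hφ n).aemeasurable) hae

lemma gagliardo_ne_top (hN : 1 ≤ N) (hs : s ∈ Set.Ioo 0 1) (hw : MemD0 s Ω w) :
    gagliardo s w ≠ ⊤ := by
  have hw_meas := hw.aemeasurable
  obtain ⟨φ, hφ, hlim, -⟩ := hw
  obtain ⟨n, hn⟩ := (hlim.eventually (gt_mem_nhds one_pos)).exists
  rw [← sub_add_cancel w (φ n)]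
  exact gagliardo_add_ne_top (hw_meas.sub (hφ n).aemeasurable) (hφ n).aemeasurable hn.ne_top
    ((hφ n).gagliardo_ne_top hN hs)

protected lemma const_smul (hw : MemD0 s Ω w) (c : ℝ) : MemD0 s Ω (c • w) := by
  obtain ⟨φ, hφ, hlim, hae⟩ := hw
  refine ⟨fun n => c • φ n, fun n => (hφ n).const_smul c, ?_, hae.mono fun x hx => hx.const_mul c⟩
  simp only [← smul_sub, gagliardo_const_smul]
  simpa using ENNReal.Tendsto.const_mul hlim (.inr ENNReal.ofReal_ne_top)

lemma lintegral_rpow_sq_add_sq_le (hN : 1 ≤ N) (hs : s ∈ Set.Ioo 0 1) (hq : 0 < q)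
    (hm : m ∈ lowerBounds (testEnergies s q Ω)) (hw : MemD0 s Ω w) (hv : MemD0 s Ω v) :
    ∫⁻ x, ENNReal.ofReal ((w x ^ 2 + v x ^ 2) ^ (q / 2)) ≤
      ENNReal.ofReal (q * ((gagliardo s w + gagliardo s v).toReal / 2 - m)) := by
  have hwv_fin : gagliardo s w + gagliardo s v ≠ ⊤ :=
    ENNReal.add_ne_top.2 ⟨hw.gagliardo_ne_top hN hs, hv.gagliardo_ne_top hN hs⟩
  have hw_meas := hw.aemeasurable
  have hv_meas := hv.aemeasurable
  obtain ⟨φ, hφ, hφw, hφ_ae⟩ := hw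
  obtain ⟨ψ, hψ, hψv, hψ_ae⟩ := hv
  set δ : ℕ → ℝ := fun n => 1 / (n + 1)
  have hδ (n : ℕ) : 0 < δ n := by positivity
  set g : ℕ → 𝔼 N → ℝ := fun n x => √(φ n x ^ 2 + ψ n x ^ 2 + δ n ^ 2) - δ n
  have hg_lim : ∀ᵐ x, Tendsto (fun n => ENNReal.ofReal (|g n x| ^ q)) atTop
      (𝓝 (ENNReal.ofReal ((w x ^ 2 + v x ^ 2) ^ (q / 2)))) := by
    filter_upwards [hφ_ae, hψ_ae] with x hφx hψx
    have hδ_lim : Tendsto δ atTop (𝓝 0) := tendsto_one_div_add_atTop_nhds_zero_nat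
    have hlim := ((((hφx.pow 2).add (hψx.pow 2)).add (hδ_lim.pow 2)).sqrt.sub hδ_lim).abs.rpow_const
      (p := q) (.inr hq.le)
    convert ENNReal.tendsto_ofReal hlim using 3
    simp [abs_rpow_eq_sq_rpow, Real.sq_sqrt (by positivity : 0 ≤ w x ^ 2 + v x ^ 2)]
  calc ∫⁻ x, ENNReal.ofReal ((w x ^ 2 + v x ^ 2) ^ (q / 2))
      = ∫⁻ x, liminf (fun n => ENNReal.ofReal (|g n x| ^ q)) atTop :=
        lintegral_congr_ae (hg_lim.mono fun x hx => hx.liminf_eq.symm)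
    _ ≤ liminf (fun n => ∫⁻ x, ENNReal.ofReal (|g n x| ^ q)) atTop :=
        lintegral_liminf_le' fun n => by
          have := ((hφ n).sqrt_sq_add_sq (hψ n) (hδ n)).aemeasurable
          fun_prop
    _ ≤ liminf (fun n => ENNReal.ofReal
          (q * ((gagliardo s (φ n) + gagliardo s (ψ n)).toReal / 2 - m))) atTop :=
        liminf_le_liminf (.of_forall fun n =>
          (hφ n).lintegral_sqrt_sq_add_sq_rpow_le hN hs hq hm (hψ n) (hδ n))
    _ = ENNReal.ofReal (q * ((gagliardo s w + gagliardo s v).toReal / 2 - m)) := by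
        refine Tendsto.liminf_eq (ENNReal.tendsto_ofReal ?_)
        have hlim := (tendsto_gagliardo_of_tendsto_sub hw_meas (fun n => (hφ n).aemeasurable)
          hφw).add (tendsto_gagliardo_of_tendsto_sub hv_meas (fun n => (hψ n).aemeasurable) hψv)
        exact ((((ENNReal.tendsto_toReal hwv_fin).comp hlim).div_const 2).sub_const m).const_mul q

lemma powerIntegral_le (hN : 1 ≤ N) (hs : s ∈ Set.Ioo 0 1) (hq : 0 < q)
    (hm : m ∈ lowerBounds (testEnergies s q Ω)) (hw : MemD0 s Ω w) :
    powerIntegral q Ω w ≤ ENNReal.ofReal (q * ((gagliardo s w).toReal / 2 - m)) := by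
  refine (setLIntegral_le_lintegral _ _).trans ?_
  simpa [abs_rpow_eq_sq_rpow] using
    hw.lintegral_rpow_sq_add_sq_le hN hs hq hm (IsTestFunction.zero (Ω := Ω)).memD0

lemma powerIntegral_ne_top (hN : 1 ≤ N) (hs : s ∈ Set.Ioo 0 1) (hq : 0 < q)
    (hm : m ∈ lowerBounds (testEnergies s q Ω)) (hw : MemD0 s Ω w) :
    powerIntegral q Ω w ≠ ⊤ :=
  ne_top_of_le_ne_top ENNReal.ofReal_ne_top (hw.powerIntegral_le hN hs hq hm)

lemma le_freeEnergy (hN : 1 ≤ N) (hs : s ∈ Set.Ioo 0 1) (hq : 0 < q)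
    (hm : m ∈ lowerBounds (testEnergies s q Ω)) (hw : MemD0 s Ω w) :
    m ≤ freeEnergy s q Ω w := by
  have hP := hw.powerIntegral_le hN hs hq hm
  have hm_nonpos : m ≤ 0 := hm (zero_mem_testEnergies hq)
  have hG : 0 ≤ (gagliardo s w).toReal := ENNReal.toReal_nonneg
  rw [ENNReal.le_ofReal_iff_toReal_le (ne_top_of_le_ne_top ENNReal.ofReal_ne_top hP)
    (mul_nonneg hq.le (by linarith)), ← inv_mul_le_iff₀ hq] at hP
  rw [freeEnergy, one_div q]
  linarith

end MemD0

section AlmostMinimizers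

variable {s q m : ℝ} {Ω : Set (𝔼 N)} {φ ψ : 𝔼 N → ℝ}

lemma integral_rpow_half_sq_add_sq_le (hN : 1 ≤ N) (hs : s ∈ Set.Ioo 0 1) (hq : 0 < q)
    (hm : m ∈ lowerBounds (testEnergies s q Ω)) (hφ : IsTestFunction Ω φ)
    (hψ : IsTestFunction Ω ψ) :
    ∫ x, ((φ x ^ 2 + ψ x ^ 2) / 2) ^ (q / 2) ≤
      q * (((gagliardo s φ).toReal + (gagliardo s ψ).toReal) / 4 - m) := by
  have hm_nonpos : m ≤ 0 := hm (zero_mem_testEnergies hq)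
  have hhalf : √(1 / 2 : ℝ) ^ 2 = 1 / 2 := Real.sq_sqrt (by norm_num)
  have hφ' := hφ.const_smul √(1 / 2)
  have hψ' := hψ.const_smul √(1 / 2)
  have hle := hφ'.memD0.lintegral_rpow_sq_add_sq_le hN hs hq hm hψ'.memD0
  rw [gagliardo_const_smul, gagliardo_const_smul, ← mul_add, ENNReal.toReal_mul, hhalf,
    ENNReal.toReal_ofReal (by positivity), ENNReal.toReal_add (hφ.gagliardo_ne_top hN hs)
      (hψ.gagliardo_ne_top hN hs), ← ofReal_integral_eq_lintegral_ofReal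
      (hφ'.integrable_rpow_sq_add_sq hψ' hq) (ae_of_all _ fun x => by positivity),
    ENNReal.ofReal_le_ofReal_iff (mul_nonneg hq.le (sub_nonneg.2
      (hm_nonpos.trans (by positivity))))] at hle
  calc ∫ x, ((φ x ^ 2 + ψ x ^ 2) / 2) ^ (q / 2)
      = ∫ x, ((√(1 / 2) • φ) x ^ 2 + (√(1 / 2) • ψ) x ^ 2) ^ (q / 2) := by
        simp only [Pi.smul_apply, smul_eq_mul, mul_pow, hhalf, one_div_mul_eq_div, ← add_div]
    _ ≤ _ := hle
    _ = _ := by ring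

lemma IsTestFunction.integrable_rpow_half_sq_add_sq (hφ : IsTestFunction Ω φ)
    (hψ : IsTestFunction Ω ψ) (hq : 0 < q) :
    Integrable fun x => ((φ x ^ 2 + ψ x ^ 2) / 2) ^ (q / 2) := by
  simpa only [Real.div_rpow (add_nonneg (sq_nonneg _) (sq_nonneg _)) zero_le_two] using
    (hφ.integrable_rpow_sq_add_sq hψ hq).div_const (2 ^ (q / 2))

lemma integral_rpow_midpoint_gap_le (hN : 1 ≤ N) (hs : s ∈ Set.Ioo 0 1) (hq : 0 < q)
    (hm : m ∈ lowerBounds (testEnergies s q Ω)) (hφ : IsTestFunction Ω φ)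
    (hψ : IsTestFunction Ω ψ) :
    ∫ x, (((φ x ^ 2 + ψ x ^ 2) / 2) ^ (q / 2) - (|φ x| ^ q + |ψ x| ^ q) / 2) ≤
      q * ((freeEnergy s q Ω φ + freeEnergy s q Ω ψ) / 2 - m) := by
  have hφ_int := hφ.integrable_abs_rpow hq
  have hψ_int := hψ.integrable_abs_rpow hq
  have hsum_int : Integrable fun x => (|φ x| ^ q + |ψ x| ^ q) / 2 :=
    (hφ_int.add hψ_int).div_const 2
  calc ∫ x, (((φ x ^ 2 + ψ x ^ 2) / 2) ^ (q / 2) - (|φ x| ^ q + |ψ x| ^ q) / 2)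
      = (∫ x, ((φ x ^ 2 + ψ x ^ 2) / 2) ^ (q / 2)) -
          ((powerIntegral q Ω φ).toReal + (powerIntegral q Ω ψ).toReal) / 2 := by
        rw [integral_sub (hφ.integrable_rpow_half_sq_add_sq hψ hq) hsum_int, integral_div,
          integral_add hφ_int hψ_int, hφ.toReal_powerIntegral hq, hψ.toReal_powerIntegral hq]
    _ ≤ q * (((gagliardo s φ).toReal + (gagliardo s ψ).toReal) / 4 - m) -
          ((powerIntegral q Ω φ).toReal + (powerIntegral q Ω ψ).toReal) / 2 := by
        gcongr
        exact integral_rpow_half_sq_add_sq_le hN hs hq hm hφ hψ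
    _ = q * ((freeEnergy s q Ω φ + freeEnergy s q Ω ψ) / 2 - m) := by
        unfold freeEnergy
        field

/-- Strong concavity of `t ↦ t ^ (q / 2)` turns the hidden convexity inequality into a bound on the
`L¹` distance between the `q`-th powers of two almost minimisers. -/
lemma sq_integral_abs_rpow_sub_le (hN : 1 ≤ N) (hs : s ∈ Set.Ioo 0 1) (hq : q ∈ Set.Ioo 0 2)
    (hm : m ∈ lowerBounds (testEnergies s q Ω)) (hφ : IsTestFunction Ω φ)
    (hψ : IsTestFunction Ω ψ) :
    q / 2 * (1 - q / 2) / 8 * (∫ x, |(|φ x| ^ q - |ψ x| ^ q)|) ^ 2 ≤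
      ((powerIntegral q Ω φ).toReal + (powerIntegral q Ω ψ).toReal) *
        (q * ((freeEnergy s q Ω φ + freeEnergy s q Ω ψ) / 2 - m)) := by
  have hp : q / 2 ∈ Set.Ioo (0 : ℝ) 1 := ⟨half_pos hq.1, by linarith [hq.2]⟩
  set κ := q / 2 * (1 - q / 2) / 8
  have hκ : 0 < κ := div_pos (mul_pos hp.1 (sub_pos.2 hp.2)) (by norm_num)
  set gap : 𝔼 N → ℝ := fun x =>
    ((φ x ^ 2 + ψ x ^ 2) / 2) ^ (q / 2) - (|φ x| ^ q + |ψ x| ^ q) / 2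
  have hgap_nonneg (x : 𝔼 N) : 0 ≤ gap x := by
    have hconc := (Real.concaveOn_rpow hp.1.le hp.2.le).2 (sq_nonneg (φ x)) (sq_nonneg (ψ x))
      one_half_pos.le one_half_pos.le (add_halves 1)
    simpa only [gap, abs_rpow_eq_sq_rpow, sub_nonneg, smul_eq_mul, one_div_mul_eq_div,
      ← add_div] using hconc
  have hgap (x : 𝔼 N) :
      (|φ x| ^ q - |ψ x| ^ q) ^ 2 ≤ (|φ x| ^ q + |ψ x| ^ q) * (κ⁻¹ * gap x) := by
    rw [mul_left_comm, ← div_eq_inv_mul, le_div_iff₀' hκ]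
    simpa only [gap, abs_rpow_eq_sq_rpow] using
      mul_sq_rpow_sub_le hp (sq_nonneg (φ x)) (sq_nonneg (ψ x))
  have hφ_int := hφ.integrable_abs_rpow hq.1
  have hψ_int := hψ.integrable_abs_rpow hq.1
  have hgap_int : Integrable gap :=
    (hφ.integrable_rpow_half_sq_add_sq hψ hq.1).sub ((hφ_int.add hψ_int).div_const 2)
  have hcs := sq_integral_abs_le_mul (hφ_int.add hψ_int) (hgap_int.const_mul κ⁻¹)
    (fun x => add_nonneg (by positivity) (by positivity))
    (fun x => mul_nonneg (inv_nonneg.2 hκ.le) (hgap_nonneg x)) hgap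
  calc κ * (∫ x, |(|φ x| ^ q - |ψ x| ^ q)|) ^ 2
      ≤ κ * ((∫ x, (|φ x| ^ q + |ψ x| ^ q)) * ∫ x, κ⁻¹ * gap x) := by
        gcongr
        exact hcs
    _ = ((powerIntegral q Ω φ).toReal + (powerIntegral q Ω ψ).toReal) * ∫ x, gap x := by
        rw [hφ.toReal_powerIntegral hq.1, hψ.toReal_powerIntegral hq.1,
          integral_add hφ_int hψ_int, integral_const_mul]
        field_simp
    _ ≤ _ := by
        gcongr
        exact integral_rpow_midpoint_gap_le hN hs hq.1 hm hφ hψ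

lemma IsTestFunction.toReal_gagliardo_sub (hN : 1 ≤ N) (hs : s ∈ Set.Ioo 0 1)
    (hφ : IsTestFunction Ω φ) (hψ : IsTestFunction Ω ψ) :
    (gagliardo s (φ - ψ)).toReal = 2 * ((gagliardo s φ).toReal + (gagliardo s ψ).toReal) -
      4 * (gagliardo s ((1 / 2 : ℝ) • (φ + ψ))).toReal := by
  have hpar_real := congrArg ENNReal.toReal
    (gagliardo_add_add_gagliardo_sub (s := s) hφ.aemeasurable hψ.aemeasurable)
  rw [ENNReal.toReal_add ((hφ.add hψ).gagliardo_ne_top hN hs)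
      ((hφ.sub hψ).gagliardo_ne_top hN hs), ENNReal.toReal_mul,
    ENNReal.toReal_add (hφ.gagliardo_ne_top hN hs) (hψ.gagliardo_ne_top hN hs),
    ENNReal.toReal_ofNat] at hpar_real
  rw [gagliardo_const_smul, ENNReal.toReal_mul, ENNReal.toReal_ofReal (by positivity)]
  linarith

lemma IsTestFunction.le_toReal_powerIntegral_midpoint (hφ : IsTestFunction Ω φ)
    (hψ : IsTestFunction Ω ψ) (hφ_nonneg : ∀ x, 0 ≤ φ x) (hψ_nonneg : ∀ x, 0 ≤ ψ x) (hq : 0 < q) :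
    ((powerIntegral q Ω φ).toReal + (powerIntegral q Ω ψ).toReal) / 2 -
        (∫ x, |(|φ x| ^ q - |ψ x| ^ q)|) / 2 ≤
      (powerIntegral q Ω ((1 / 2 : ℝ) • (φ + ψ))).toReal := by
  have hφ_int := hφ.integrable_abs_rpow hq
  have hψ_int := hψ.integrable_abs_rpow hq
  have hsum_int : Integrable fun x => (|φ x| ^ q + |ψ x| ^ q) / 2 :=
    (hφ_int.add hψ_int).div_const 2
  have hdiff_int : Integrable fun x => |(|φ x| ^ q - |ψ x| ^ q)| / 2 :=
    (hφ_int.sub hψ_int).abs.div_const 2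
  have hmid : IsTestFunction Ω ((1 / 2 : ℝ) • (φ + ψ)) := (hφ.add hψ).const_smul _
  rw [hφ.toReal_powerIntegral hq, hψ.toReal_powerIntegral hq, hmid.toReal_powerIntegral hq,
    ← integral_add hφ_int hψ_int, ← integral_div, ← integral_div,
    ← integral_sub hsum_int hdiff_int]
  refine integral_mono (hsum_int.sub hdiff_int) (hmid.integrable_abs_rpow hq) fun x => ?_
  simpa only [Pi.smul_apply, Pi.add_apply, smul_eq_mul, one_div_mul_eq_div, abs_div, abs_two,
    abs_of_nonneg (hφ_nonneg x), abs_of_nonneg (hψ_nonneg x),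
    abs_of_nonneg (add_nonneg (hφ_nonneg x) (hψ_nonneg x))] using
    half_add_sub_half_abs_sub_le_midpoint_rpow hq.le (hφ_nonneg x) (hψ_nonneg x)

/-- The parallelogram law, with `(φ + ψ) / 2` as a competitor. -/
lemma toReal_gagliardo_sub_le (hN : 1 ≤ N) (hs : s ∈ Set.Ioo 0 1) (hq : 0 < q)
    (hm : m ∈ lowerBounds (testEnergies s q Ω)) (hφ : IsTestFunction Ω φ)
    (hψ : IsTestFunction Ω ψ) (hφ_nonneg : ∀ x, 0 ≤ φ x) (hψ_nonneg : ∀ x, 0 ≤ ψ x) :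
    (gagliardo s (φ - ψ)).toReal ≤ 8 * ((freeEnergy s q Ω φ + freeEnergy s q Ω ψ) / 2 - m) +
      4 / q * ∫ x, |(|φ x| ^ q - |ψ x| ^ q)| := by
  have henergy : m ≤ freeEnergy s q Ω ((1 / 2 : ℝ) • (φ + ψ)) :=
    le_freeEnergy_of_mem_lowerBounds hm ((hφ.add hψ).const_smul _) fun x =>
      mul_nonneg (by norm_num) (add_nonneg (hφ_nonneg x) (hψ_nonneg x))
  have hpower := mul_le_mul_of_nonneg_left
    (hφ.le_toReal_powerIntegral_midpoint hψ hφ_nonneg hψ_nonneg hq) (one_div_nonneg.2 hq.le)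
  rw [hφ.toReal_gagliardo_sub hN hs hψ, show 4 / q = 4 * (1 / q) by ring]
  unfold freeEnergy at henergy ⊢
  linarith

end AlmostMinimizers

section MinimizingSequences

variable {s q m : ℝ} {Ω : Set (𝔼 N)} {f : ℕ → 𝔼 N → ℝ}

lemma tendsto_freeEnergy_add_half_sub
    (hF : Tendsto (fun n => freeEnergy s q Ω (f n)) atTop (𝓝 m)) :
    Tendsto (fun k : ℕ × ℕ => (freeEnergy s q Ω (f k.1) + freeEnergy s q Ω (f k.2)) / 2 - m)
      atTop (𝓝 0) := by
  rw [← prod_atTop_atTop_eq]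
  simpa using (((hF.comp tendsto_fst).add (hF.comp tendsto_snd)).div_const 2).sub_const m

lemma tendsto_integral_abs_rpow_sub (hN : 1 ≤ N) (hs : s ∈ Set.Ioo 0 1) (hq : q ∈ Set.Ioo 0 2)
    (hl : 0 < lambda1 s q Ω) (hm : m ∈ lowerBounds (testEnergies s q Ω))
    (hf : ∀ n, IsTestFunction Ω (f n)) (hf_nonneg : ∀ n x, 0 ≤ f n x)
    (hF : Tendsto (fun n => freeEnergy s q Ω (f n)) atTop (𝓝 m)) :
    Tendsto (fun k : ℕ × ℕ => ∫ x, |(|f k.1 x| ^ q - |f k.2 x| ^ q)|) atTop (𝓝 0) := by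
  obtain ⟨C, hC⟩ := exists_toReal_powerIntegral_le_freeEnergy hN hs hq hl
  set κ := q / 2 * (1 - q / 2) / 8
  have hκ : 0 < κ :=
    div_pos (mul_pos (half_pos hq.1) (by linarith [hq.2])) (by norm_num)
  set gap : ℕ × ℕ → ℝ :=
    fun k => (freeEnergy s q Ω (f k.1) + freeEnergy s q Ω (f k.2)) / 2 - m
  have hgap : Tendsto gap atTop (𝓝 0) := tendsto_freeEnergy_add_half_sub hF
  have hgap_nonneg (k : ℕ × ℕ) : 0 ≤ gap k := by
    simp only [gap]
    linarith [le_freeEnergy_of_mem_lowerBounds hm (hf k.1) (hf_nonneg k.1),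
      le_freeEnergy_of_mem_lowerBounds hm (hf k.2) (hf_nonneg k.2)]
  have hbound (k : ℕ × ℕ) : (∫ x, |(|f k.1 x| ^ q - |f k.2 x| ^ q)|) ^ 2 ≤
      (2 * (q * (gap k + m) + C)) * (q * gap k) / κ := by
    rw [le_div_iff₀' hκ]
    refine (sq_integral_abs_rpow_sub_le hN hs hq hm (hf k.1) (hf k.2)).trans
      (mul_le_mul_of_nonneg_right ?_ (mul_nonneg hq.1.le (hgap_nonneg k)))
    simp only [gap]
    linarith [hC _ (hf k.1), hC _ (hf k.2)]
  have hlim : Tendsto (fun k => (2 * (q * (gap k + m) + C)) * (q * gap k) / κ) atTop (𝓝 0) := by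
    simpa using (((((hgap.add_const m).const_mul q).add_const C).const_mul 2).mul
      (hgap.const_mul q)).div_const κ
  have hsq := squeeze_zero (fun k => sq_nonneg _) hbound hlim
  simpa [Real.sqrt_sq (integral_nonneg fun _ => abs_nonneg _)] using hsq.sqrt

lemma tendsto_gagliardo_sub (hN : 1 ≤ N) (hs : s ∈ Set.Ioo 0 1) (hq : q ∈ Set.Ioo 0 2)
    (hl : 0 < lambda1 s q Ω) (hm : m ∈ lowerBounds (testEnergies s q Ω))
    (hf : ∀ n, IsTestFunction Ω (f n)) (hf_nonneg : ∀ n x, 0 ≤ f n x)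
    (hF : Tendsto (fun n => freeEnergy s q Ω (f n)) atTop (𝓝 m)) :
    Tendsto (fun k : ℕ × ℕ => gagliardo s (f k.1 - f k.2)) atTop (𝓝 0) := by
  have hfin (k : ℕ × ℕ) : gagliardo s (f k.1 - f k.2) ≠ ⊤ :=
    ((hf k.1).sub (hf k.2)).gagliardo_ne_top hN hs
  rw [← ENNReal.tendsto_toReal_zero_iff hfin]
  refine squeeze_zero (fun k => ENNReal.toReal_nonneg) (fun k => toReal_gagliardo_sub_le hN hs
    hq.1 hm (hf k.1) (hf k.2) (hf_nonneg k.1) (hf_nonneg k.2)) ?_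
  simpa using ((tendsto_freeEnergy_add_half_sub hF).const_mul 8).add
    ((tendsto_integral_abs_rpow_sub hN hs hq hl hm hf hf_nonneg hF).const_mul (4 / q))

end MinimizingSequences

section Existence

lemma exists_seq_tendsto_ae_of_cauchy_rpow {α : Type*} [MeasurableSpace α] {μ : Measure α} {q : ℝ}
    (hq : 0 < q) {f : ℕ → α → ℝ} (hf_nonneg : ∀ n x, 0 ≤ f n x)
    (hf : ∀ n, Integrable (fun x => |f n x| ^ q) μ)
    (hcauchy : Tendsto (fun k : ℕ × ℕ => ∫ x, |(|f k.1 x| ^ q - |f k.2 x| ^ q)| ∂μ) atTop (𝓝 0)) :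
    ∃ (w : α → ℝ) (ns : ℕ → ℕ), (∀ x, 0 ≤ w x) ∧ StrictMono ns ∧
      (∀ᵐ x ∂μ, Tendsto (fun n => f (ns n) x) atTop (𝓝 (w x))) ∧
      ∀ A : Set α, Tendsto (fun n => ∫ x in A, |f (ns n) x| ^ q ∂μ) atTop
        (𝓝 (∫ x in A, |w x| ^ q ∂μ)) := by
  obtain ⟨h, hh, hlim⟩ := exists_integrable_tendsto_eLpNorm_of_cauchy hf hcauchy
  obtain ⟨ns, hns, hae⟩ := (tendstoInMeasure_of_tendsto_eLpNorm one_ne_zero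
    (fun n => (hf n).aestronglyMeasurable) hh.aestronglyMeasurable hlim).exists_seq_tendsto_ae
  have hw_rpow : (fun x => |(|h x| ^ q⁻¹)| ^ q) =ᵐ[μ] h := by
    filter_upwards [hae] with x hx
    rw [abs_of_nonneg (by positivity), Real.rpow_inv_rpow (abs_nonneg _) hq.ne',
      abs_of_nonneg (ge_of_tendsto' hx fun n => by positivity)]
  refine ⟨fun x => |h x| ^ q⁻¹, ns, fun x => by positivity, hns, ?_, fun A => ?_⟩
  · filter_upwards [hae] with x hx
    simpa [abs_of_nonneg (Real.rpow_nonneg (hf_nonneg _ x) q), abs_of_nonneg (hf_nonneg _ x),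
      Real.rpow_rpow_inv (hf_nonneg _ x) hq.ne'] using
      hx.abs.rpow_const (p := q⁻¹) (.inr (inv_nonneg.2 hq.le))
  · rw [integral_congr_ae (ae_restrict_of_ae hw_rpow)]
    exact (tendsto_setIntegral_of_L1' h hh.aestronglyMeasurable (.of_forall hf) hlim A).comp
      hns.tendsto_atTop

variable {s q : ℝ} {Ω : Set (𝔼 N)}

lemma toReal_powerIntegral_eq_setIntegral {u : 𝔼 N → ℝ} (hu : AEMeasurable u) :
    (powerIntegral q Ω u).toReal = ∫ x in Ω, |u x| ^ q := by
  rw [integral_eq_lintegral_of_nonneg_ae (ae_of_all _ fun x => by positivity)]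
  · rfl
  · have := hu.restrict (s := Ω)
    exact (by fun_prop : AEMeasurable (fun x => |u x| ^ q) _).aestronglyMeasurable

theorem exists_isLeastEnergy (hN : 1 ≤ N) (hs : s ∈ Set.Ioo 0 1) (hq : q ∈ Set.Ioo 0 2)
    (hl : 0 < lambda1 s q Ω) : ∃ w, IsLeastEnergy s q Ω w := by
  obtain ⟨m, hm⟩ := exists_isGLB_testEnergies hN hs hq hl
  obtain ⟨_, -, -, hlim, hmem⟩ :=
    hm.exists_seq_antitone_tendsto ⟨0, zero_mem_testEnergies hq.1⟩
  choose f hf hfE using hmem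
  have hf_nonneg (n : ℕ) (x : 𝔼 N) : 0 ≤ f n x := (hf n).2 x
  have hf_test (n : ℕ) : IsTestFunction Ω (f n) := (hf n).1
  have hE : Tendsto (fun n => freeEnergy s q Ω (f n)) atTop (𝓝 m) := by simpa only [hfE] using hlim
  obtain ⟨w, ns, hw_nonneg, hns, hae, hpow⟩ := exists_seq_tendsto_ae_of_cauchy_rpow hq.1 hf_nonneg
    (fun n => (hf_test n).integrable_abs_rpow hq.1)
    (tendsto_integral_abs_rpow_sub hN hs hq hl hm.1 hf_test hf_nonneg hE)
  have hE' : Tendsto (fun n => freeEnergy s q Ω (f (ns n))) atTop (𝓝 m) :=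
    hE.comp hns.tendsto_atTop
  have hf_meas (n : ℕ) : AEMeasurable (f (ns n)) := (hf_test _).aemeasurable
  have hcauchy := tendsto_gagliardo_sub hN hs hq hl hm.1 (f := fun n => f (ns n))
    (fun n => hf_test (ns n)) (fun n => hf_nonneg (ns n)) hE'
  have hG := tendsto_gagliardo_sub_of_cauchy hf_meas hcauchy hae
  have hw : MemD0 s Ω w := ⟨fun n => f (ns n), fun n => hf_test (ns n), hG, hae⟩
  have hP : Tendsto (fun n => (powerIntegral q Ω (f (ns n))).toReal) atTop
      (𝓝 (powerIntegral q Ω w).toReal) := by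
    simpa only [toReal_powerIntegral_eq_setIntegral hw.aemeasurable,
      toReal_powerIntegral_eq_setIntegral (hf_meas _)] using hpow Ω
  have hwE : freeEnergy s q Ω w = m := by
    refine tendsto_nhds_unique (Tendsto.sub (Tendsto.const_mul _ ?_) (hP.const_mul _)) hE'
    exact (ENNReal.tendsto_toReal (hw.gagliardo_ne_top hN hs)).comp
      (tendsto_gagliardo_of_tendsto_sub hw.aemeasurable hf_meas hG)
  exact ⟨w, hw, ae_of_all _ hw_nonneg, fun φ hφ _ => hwE ▸ hφ.le_freeEnergy hN hs hq.1 hm.1⟩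

lemma isLeastEnergy_leastEnergy (hN : 1 ≤ N) (hs : s ∈ Set.Ioo 0 1) (hq : q ∈ Set.Ioo 0 2)
    (hl : 0 < lambda1 s q Ω) : IsLeastEnergy s q Ω (leastEnergy s q Ω) := by
  have hex := exists_isLeastEnergy hN hs hq hl
  rw [leastEnergy, dif_pos hex]
  exact hex.choose_spec

end Existence

section Minimizer

variable {s q : ℝ} {Ω : Set (𝔼 N)} {u w : 𝔼 N → ℝ}

namespace IsLeastEnergy

lemma freeEnergy_mem_lowerBounds (hw : IsLeastEnergy s q Ω w) :
    freeEnergy s q Ω w ∈ lowerBounds (testEnergies s q Ω) := by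
  rintro _ ⟨φ, ⟨hφ, hφ_nonneg⟩, rfl⟩
  exact hw.le φ hφ.memD0 (ae_of_all _ hφ_nonneg)

/-- Hidden convexity for the pair `w`, `√t u`. -/
lemma lintegral_rpow_sq_add_mul_sq_le (hN : 1 ≤ N) (hs : s ∈ Set.Ioo 0 1) (hq : 0 < q)
    (hw : IsLeastEnergy s q Ω w) (hu : MemD0 s Ω u) {t : ℝ} (ht : 0 ≤ t) :
    ∫⁻ x in Ω, ENNReal.ofReal ((w x ^ 2 + t * u x ^ 2) ^ (q / 2)) ≤
      ENNReal.ofReal (q / 2 * t) * gagliardo s u + powerIntegral q Ω w := by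
  have hconv := hw.mem.lintegral_rpow_sq_add_sq_le hN hs hq hw.freeEnergy_mem_lowerBounds
    (hu.const_smul √t)
  have hP := hw.mem.powerIntegral_ne_top hN hs hq hw.freeEnergy_mem_lowerBounds
  have hG := hu.gagliardo_ne_top hN hs
  simp only [Pi.smul_apply, smul_eq_mul, mul_pow, gagliardo_const_smul, Real.sq_sqrt ht] at hconv
  refine (setLIntegral_le_lintegral _ _).trans (hconv.trans (le_of_eq ?_))
  rw [ENNReal.toReal_add (hw.mem.gagliardo_ne_top hN hs) (by finiteness), ENNReal.toReal_mul,
    ENNReal.toReal_ofReal ht, ← ENNReal.ofReal_toReal hG, ← ENNReal.ofReal_mul (by positivity),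
    ← ENNReal.ofReal_toReal hP, ← ENNReal.ofReal_add (by positivity) (by positivity)]
  simp only [ENNReal.toReal_ofReal ENNReal.toReal_nonneg]
  congr 1
  unfold freeEnergy
  field

/-- The tangent line to the concave function `r ↦ r ^ (q / 2)` at `w² + t u²`. -/
lemma lintegral_sq_div_rpow_le (hN : 1 ≤ N) (hs : s ∈ Set.Ioo 0 1) (hq : q ∈ Set.Ioo 0 2)
    (hw : IsLeastEnergy s q Ω w) (hu : MemD0 s Ω u) {t : ℝ} (ht : 0 < t) :
    ∫⁻ x in Ω, ENNReal.ofReal (u x ^ 2 / (w x ^ 2 + t * u x ^ 2) ^ (1 - q / 2)) ≤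
      gagliardo s u := by
  have hq_pos : 0 < q := hq.1
  have hP := hw.mem.powerIntegral_ne_top hN hs hq.1 hw.freeEnergy_mem_lowerBounds
  have htangent : ENNReal.ofReal (q / 2 * t) *
        (∫⁻ x in Ω, ENNReal.ofReal (u x ^ 2 / (w x ^ 2 + t * u x ^ 2) ^ (1 - q / 2))) +
        powerIntegral q Ω w ≤
      ∫⁻ x in Ω, ENNReal.ofReal ((w x ^ 2 + t * u x ^ 2) ^ (q / 2)) := by
    have hw_meas := hw.mem.aemeasurable.restrict (s := Ω)
    rw [← lintegral_const_mul' _ _ ENNReal.ofReal_ne_top, powerIntegral,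
      ← lintegral_add_right' _ (by fun_prop)]
    refine lintegral_mono fun x => ?_
    rw [← ENNReal.ofReal_mul (by positivity), ← ENNReal.ofReal_add (by positivity) (by positivity),
      abs_rpow_eq_sq_rpow, mul_assoc, ← mul_div_assoc]
    exact ENNReal.ofReal_le_ofReal (mul_div_rpow_add_rpow_le ⟨by positivity, by linarith [hq.2]⟩
      (sq_nonneg (w x)) (mul_nonneg ht.le (sq_nonneg (u x))))
  refine (ENNReal.mul_le_mul_iff_right ?_ ENNReal.ofReal_ne_top).1
    ((ENNReal.add_le_add_iff_right hP).1
      (htangent.trans (hw.lintegral_rpow_sq_add_mul_sq_le hN hs hq.1 hu ht.le)))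
  exact (ENNReal.ofReal_pos.2 (by positivity)).ne'

theorem lintegral_div_le (hN : 1 ≤ N) (hs : s ∈ Set.Ioo 0 1) (hq : q ∈ Set.Ioo 0 2)
    (hw : IsLeastEnergy s q Ω w) (hu : MemD0 s Ω u) :
    ∫⁻ x in Ω, ENNReal.ofReal (u x ^ 2) / ENNReal.ofReal (w x) ^ (2 - q) ≤ gagliardo s u := by
  have hw_meas := hw.mem.aemeasurable.restrict (s := Ω)
  have hu_meas := hu.aemeasurable.restrict (s := Ω)
  set t : ℕ → ℝ := fun n => 1 / (n + 1)
  have ht (n : ℕ) : 0 < t n := by positivity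
  have ht_lim : Tendsto t atTop (𝓝 0) := tendsto_one_div_add_atTop_nhds_zero_nat
  have hlim {x : 𝔼 N} (hwx : 0 ≤ w x) (hux : u x ≠ 0) :
      Tendsto (fun n => ENNReal.ofReal (u x ^ 2 / (w x ^ 2 + t n * u x ^ 2) ^ (1 - q / 2))) atTop
        (𝓝 (ENNReal.ofReal (u x ^ 2) / ENNReal.ofReal (w x) ^ (2 - q))) := by
    have hux_sq : 0 < u x ^ 2 := by positivity
    have hpos (n : ℕ) : 0 < w x ^ 2 + t n * u x ^ 2 :=
      add_pos_of_nonneg_of_pos (sq_nonneg _) (mul_pos (ht n) hux_sq)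
    have hpow : ENNReal.ofReal (w x) ^ (2 - q) = ENNReal.ofReal (w x ^ 2) ^ (1 - q / 2) := by
      rw [ENNReal.ofReal_pow hwx, ← ENNReal.rpow_ofNat, ← ENNReal.rpow_mul, mul_sub, mul_one,
        mul_div_cancel₀ q two_ne_zero]
    simp only [ENNReal.ofReal_div_of_pos (Real.rpow_pos_of_pos (hpos _) _),
      ← ENNReal.ofReal_rpow_of_pos (hpos _), hpow]
    refine ENNReal.Tendsto.div tendsto_const_nhds (.inl (by simpa using hux))
      (.ennrpow_const _ (ENNReal.tendsto_ofReal ?_)) (.inr ENNReal.ofReal_ne_top)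
    simpa using (ht_lim.mul_const (u x ^ 2)).const_add (w x ^ 2)
  calc ∫⁻ x in Ω, ENNReal.ofReal (u x ^ 2) / ENNReal.ofReal (w x) ^ (2 - q)
      ≤ ∫⁻ x in Ω, liminf (fun n =>
          ENNReal.ofReal (u x ^ 2 / (w x ^ 2 + t n * u x ^ 2) ^ (1 - q / 2))) atTop := by
        refine lintegral_mono_ae (hw.nonneg.mono fun x hwx => ?_)
        by_cases hux : u x = 0
        · simp [hux]
        · exact (hlim hwx hux).liminf_eq.ge
    _ ≤ liminf (fun n => ∫⁻ x in Ω,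
          ENNReal.ofReal (u x ^ 2 / (w x ^ 2 + t n * u x ^ 2) ^ (1 - q / 2))) atTop :=
        lintegral_liminf_le' fun n => by fun_prop
    _ ≤ gagliardo s u := liminf_le_of_frequently_le' (.of_forall fun n =>
        hw.lintegral_sq_div_rpow_le hN hs hq hu (ht n))

end IsLeastEnergy

end Minimizer

section BoundedSets

variable {s q : ℝ} {Ω : Set (𝔼 N)}

lemma mul_lintegral_sq_le_gagliardo (hs : 0 ≤ s) {φ : 𝔼 N → ℝ} {B : Set (𝔼 N)} {ρ : ℝ}
    (hB : MeasurableSet B) (hφB : ∀ y ∈ B, φ y = 0)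
    (hdist : ∀ x, φ x ≠ 0 → ∀ y ∈ B, ‖x - y‖ ≤ ρ) :
    ENNReal.ofReal (ρ ^ (N + 2 * s))⁻¹ * volume B * ∫⁻ x, ENNReal.ofReal (φ x ^ 2) ≤
      gagliardo s φ := by
  refine (lintegral_const_mul_le _ _).trans (lintegral_mono fun x => ?_)
  by_cases hx : φ x = 0
  · simp [hx]
  calc ENNReal.ofReal (ρ ^ (N + 2 * s))⁻¹ * volume B * ENNReal.ofReal (φ x ^ 2)
      = ∫⁻ _ in B, ENNReal.ofReal (φ x ^ 2 / ρ ^ (N + 2 * s)) := by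
        rw [setLIntegral_const, div_eq_mul_inv, ENNReal.ofReal_mul (sq_nonneg _)]
        ring
    _ ≤ ∫⁻ y in B, ENNReal.ofReal ((φ x - φ y) ^ 2 / ‖x - y‖ ^ (N + 2 * s)) := by
        refine setLIntegral_mono' hB fun y hy => ?_
        have hxy : 0 < ‖x - y‖ := norm_sub_pos_iff.2 fun h => hx (h ▸ hφB y hy)
        rw [hφB y hy, sub_zero]
        gcongr
        exact hdist x hx y hy
    _ ≤ _ := setLIntegral_le_lintegral _ _

/-- Fractional Poincaré inequality: for `x ∈ Ω`, integrate the Gagliardo quotient in `y` over a ball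
disjoint from `Ω`. -/
lemma exists_mul_lintegral_sq_le_gagliardo (hN : 1 ≤ N) (hs : 0 ≤ s)
    (hΩ : Bornology.IsBounded Ω) :
    ∃ c : ℝ≥0∞, c ≠ 0 ∧ ∀ φ, IsTestFunction Ω φ →
      c * ∫⁻ x, ENNReal.ofReal (φ x ^ 2) ≤ gagliardo s φ := by
  obtain ⟨R, hR, hΩR⟩ := hΩ.subset_ball_lt 0 0
  obtain ⟨z, hz⟩ : ∃ z : 𝔼 N, ‖z‖ = R + 1 :=
    ⟨EuclideanSpace.single ⟨0, hN⟩ (R + 1), by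
      rw [PiLp.norm_single, Real.norm_of_nonneg (by positivity)]⟩
  have hdisj : Disjoint (Metric.ball 0 R) (Metric.ball z 1) :=
    Metric.ball_disjoint_ball (by rw [dist_zero_left, hz])
  refine ⟨ENNReal.ofReal ((2 * R + 2) ^ (N + 2 * s))⁻¹ * volume (Metric.ball z 1),
    mul_ne_zero (ENNReal.ofReal_pos.2 (by positivity)).ne'
      (Metric.measure_ball_pos volume z one_pos).ne', fun φ hφ => ?_⟩
  have hφ_support {x : 𝔼 N} (hx : φ x ≠ 0) : x ∈ Metric.ball 0 R :=
    hΩR (by_contra fun hxΩ => hx (hφ.eq_zero_of_notMem hxΩ))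
  refine mul_lintegral_sq_le_gagliardo hs measurableSet_ball
    (fun y hy => by_contra fun hφy => hdisj.notMem_of_mem_left (hφ_support hφy) hy)
    fun x hx y hy => ?_
  have hx_norm : ‖x‖ < R := mem_ball_zero_iff.1 (hφ_support hx)
  have hyz_norm : ‖y - z‖ < 1 := mem_ball_iff_norm.1 hy
  linarith [norm_sub_le x y, norm_sub_norm_le y z]

lemma powerIntegral_eq_eLpNorm'_rpow (hq : 0 < q) (u : 𝔼 N → ℝ) :
    powerIntegral q Ω u = eLpNorm' u q (volume.restrict Ω) ^ q := by
  rw [← lintegral_rpow_enorm_eq_rpow_eLpNorm' hq, powerIntegral]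
  simp only [Real.enorm_eq_ofReal_abs, ENNReal.ofReal_rpow_of_nonneg (abs_nonneg _) hq.le]

lemma lambda1_pos_of_isBounded (hN : 1 ≤ N) (hs : 0 ≤ s) (hq : q ∈ Set.Ioc 0 2)
    (hΩ : Bornology.IsBounded Ω) : 0 < lambda1 s q Ω := by
  obtain ⟨c, hc, hpoincare⟩ := exists_mul_lintegral_sq_le_gagliardo hN hs hΩ
  set V := volume Ω ^ (1 / q - 1 / 2)
  have hV : V ≠ ⊤ := ENNReal.rpow_ne_top_of_nonneg
    (sub_nonneg.2 (one_div_le_one_div_of_le hq.1 hq.2)) hΩ.measure_lt_top.ne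
  refine lt_of_lt_of_le (b := c * (1 / V) ^ (2 : ℝ)) ?_
    (le_iInf₂ fun φ hφ => le_iInf fun hunit => ?_)
  · exact ENNReal.mul_pos hc (ENNReal.rpow_pos_of_nonneg
      (ENNReal.div_pos one_ne_zero hV) two_pos.le).ne'
  have holder : eLpNorm' φ q (volume.restrict Ω) ≤ eLpNorm' φ 2 (volume.restrict Ω) * V := by
    simpa only [V, Measure.restrict_apply_univ] using eLpNorm'_le_eLpNorm'_mul_rpow_measure_univ
      hq.1 hq.2 (hφ.continuous.aestronglyMeasurable (μ := volume.restrict Ω))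
  have hnorm : eLpNorm' φ q (volume.restrict Ω) = 1 := by
    rw [powerIntegral_eq_eLpNorm'_rpow hq.1, ← ENNReal.one_rpow q] at hunit
    exact ENNReal.rpow_left_injective hq.1.ne' hunit
  calc c * (1 / V) ^ (2 : ℝ) ≤ c * eLpNorm' φ 2 (volume.restrict Ω) ^ (2 : ℝ) := by
        gcongr
        exact ENNReal.div_le_of_le_mul (hnorm ▸ holder)
    _ = c * powerIntegral 2 Ω φ := by rw [powerIntegral_eq_eLpNorm'_rpow two_pos]
    _ ≤ c * ∫⁻ x, ENNReal.ofReal (φ x ^ 2) := by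
        gcongr
        simpa only [powerIntegral, Real.rpow_two, sq_abs] using setLIntegral_le_lintegral Ω _
    _ ≤ gagliardo s φ := hpoincare φ hφ

end BoundedSets

section Exhaustion

variable {s q : ℝ} {Ω : Set (𝔼 N)} {u : 𝔼 N → ℝ}

lemma div_limsup_rpow_eq_liminf {p : ℝ} (hp : 0 ≤ p) {c : ℝ≥0∞} (hc_zero : c ≠ 0) (hc_top : c ≠ ⊤)
    (a : ℕ → ℝ≥0∞) :
    c / limsup a atTop ^ p = liminf (fun n => c / a n ^ p) atTop := by
  have hanti : Antitone fun t : ℝ≥0∞ => c / t ^ p := fun _ _ h =>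
    ENNReal.div_le_div_left (ENNReal.rpow_le_rpow h hp) c
  exact hanti.map_limsup_of_continuousAt a (ENNReal.Tendsto.div tendsto_const_nhds (.inl hc_zero)
    (ENNReal.continuous_rpow_const.tendsto _) (.inr hc_top))

lemma IsTestFunction.eventually_inter_ball (hu : IsTestFunction Ω u) :
    ∀ᶠ n : ℕ in atTop, IsTestFunction (Ω ∩ Metric.ball 0 n) u := by
  obtain ⟨R, hR⟩ := hu.compact.isCompact.isBounded.subset_ball 0
  filter_upwards [eventually_ge_atTop ⌈R⌉₊] with n hn
  exact ⟨hu.smooth, hu.compact,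
    Set.subset_inter hu.supp (hR.trans (Metric.ball_subset_ball (Nat.ceil_le.1 hn)))⟩

lemma lintegral_sq_div_eq_of_subset {U : Set (𝔼 N)} (hu : IsTestFunction U u) (hU : U ⊆ Ω)
    (f : 𝔼 N → ℝ≥0∞) :
    ∫⁻ x in Ω, ENNReal.ofReal (u x ^ 2) / f x = ∫⁻ x in U, ENNReal.ofReal (u x ^ 2) / f x := by
  have hsupp : (fun x => ENNReal.ofReal (u x ^ 2) / f x).support ⊆ U := fun x hx =>
    by_contra fun hxU => hx (by simp [hu.eq_zero_of_notMem hxU])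
  rw [setLIntegral_eq_of_support_subset hsupp, setLIntegral_eq_of_support_subset (hsupp.trans hU)]

theorem lintegral_div_limsup_leastEnergy_le (hN : 1 ≤ N) (hs : s ∈ Set.Ioo 0 1)
    (hq : q ∈ Set.Ioo 0 2) (hu : IsTestFunction Ω u) :
    ∫⁻ x in Ω, ENNReal.ofReal (u x ^ 2) / limsup (fun n : ℕ =>
        ENNReal.ofReal (leastEnergy s q (Ω ∩ Metric.ball 0 n) x)) atTop ^ (2 - q) ≤
      gagliardo s u := by
  set w : ℕ → 𝔼 N → ℝ := fun n => leastEnergy s q (Ω ∩ Metric.ball 0 n)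
  have hw (n : ℕ) : IsLeastEnergy s q (Ω ∩ Metric.ball 0 n) (w n) :=
    isLeastEnergy_leastEnergy hN hs hq (lambda1_pos_of_isBounded hN hs.1.le ⟨hq.1, hq.2.le⟩
      (Metric.isBounded_ball.subset Set.inter_subset_right))
  have hw_meas (n : ℕ) : AEMeasurable (w n) (volume.restrict Ω) := (hw n).mem.aemeasurable.restrict
  have hu_meas : AEMeasurable u (volume.restrict Ω) := hu.aemeasurable.restrict
  calc ∫⁻ x in Ω, ENNReal.ofReal (u x ^ 2) /
          limsup (fun n => ENNReal.ofReal (w n x)) atTop ^ (2 - q)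
      ≤ ∫⁻ x in Ω, liminf (fun n =>
          ENNReal.ofReal (u x ^ 2) / ENNReal.ofReal (w n x) ^ (2 - q)) atTop := by
        refine lintegral_mono fun x => ?_
        by_cases hux : u x = 0
        · simp [hux]
        · exact (div_limsup_rpow_eq_liminf (sub_nonneg.2 hq.2.le) (by simpa using hux)
            ENNReal.ofReal_ne_top _).le
    _ ≤ liminf (fun n => ∫⁻ x in Ω,
          ENNReal.ofReal (u x ^ 2) / ENNReal.ofReal (w n x) ^ (2 - q)) atTop :=
        lintegral_liminf_le' fun n => by fun_prop
    _ ≤ gagliardo s u := by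
        refine liminf_le_of_frequently_le'
          (hu.eventually_inter_ball.mono fun n hun => ?_).frequently
        rw [lintegral_sq_div_eq_of_subset hun Set.inter_subset_left]
        exact (hw n).lintegral_div_le hN hs hq hun.memD0

end Exhaustion

end FracLaneEmden

theorem mainTheorem4_general {N : ℕ} (hN : 1 ≤ N) {s : ℝ} (hs0 : 0 < s) (hs1 : s < 1)
    {q : ℝ} (hq0 : 0 < q) (hq2 : q < 2) {Ω : Set (EuclideanSpace ℝ (Fin N))}
    {u : EuclideanSpace ℝ (Fin N) → ℝ} (hu : FracLaneEmden.IsTestFunction Ω u) :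
    ∫⁻ x in Ω, ENNReal.ofReal (u x ^ 2) / FracLaneEmden.laneEmdenDensity s q Ω x ^ (2 - q) ≤
      FracLaneEmden.gagliardo s u := by
  have hs : s ∈ Set.Ioo 0 1 := ⟨hs0, hs1⟩
  have hq : q ∈ Set.Ioo 0 2 := ⟨hq0, hq2⟩
  by_cases hl : 0 < FracLaneEmden.lambda1 s q Ω
  · simp only [FracLaneEmden.laneEmdenDensity, if_pos hl]
    have hw := FracLaneEmden.isLeastEnergy_leastEnergy hN hs hq hl
    exact hw.lintegral_div_le hN hs hq hu.memD0
  · simp only [FracLaneEmden.laneEmdenDensity, if_neg hl]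
    exact FracLaneEmden.lintegral_div_limsup_leastEnergy_le hN hs hq hu

/-- The quotient is taken in `[0, ∞]`: it is `0` where the density is `∞` (and where `u = 0`),
and it is `∞` where the density vanishes and `u ≠ 0`. -/
theorem mainTheorem4 {N : ℕ} (hN : 1 ≤ N) {s : ℝ} (hs0 : 0 < s) (hs1 : s < 1)
    {q : ℝ} (hq1 : 1 < q) (hq2 : q < 2)
    {Ω : Set (EuclideanSpace ℝ (Fin N))} (hΩ : IsOpen Ω)
    {u : EuclideanSpace ℝ (Fin N) → ℝ} (hu : FracLaneEmden.IsTestFunction Ω u) :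
    ∫⁻ x in Ω, ENNReal.ofReal (u x ^ 2) / FracLaneEmden.laneEmdenDensity s q Ω x ^ (2 - q) ≤
      FracLaneEmden.gagliardo s u := by
  exact mainTheorem4_general hN hs0 hs1 (one_pos.trans hq1) hq2 hu
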